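/- **Setting.** Let $(X_n)_{n\ge 0}$ be a time-homogeneous Markov chain on a measurable space $D\cup\{\partial\}$, absorbed at $\partial\notin D$ at time $\tau_\partial$, and for $A\subset D$ measurable let $T_A=\inf\{n\ge 0: X_n\in A\}$. Functions are extended by $0$ outside their domain. For $W\ge 1$ measurable, $L^\infty(W)$ is the set of measurable $f$ with $\|f\|_W:=\sup|f|/W<\infty$, and $\mathcal M(W)$ is the set of signed measures $\mu$ with $|\mu|(W)<\infty$. For the process killed when it leaves a set $A$, with sub-Markovian semigroup $(S_n)$ on $A$, put $\theta_S(x)=\inf\{\theta\ge 0:\liminf_n \theta^{-n}S_n\mathbf 1(x)=0\}$, $\theta_{0,S}=\sup_{x\in A}\theta_S(x)$, $j_S(x)=\inf\{\ell\ge 0:\liminf_n n^{-\ell}\theta_{0,S}^{-n}S_n\mathbf 1(x)=0\}$ (with $\inf\emptyset=0$), $j_{0,S}=\sup_{x\in A}j_S(x)$. *Assumption (A)* for $(S_n)$ on $A$: $\theta_{0,S}\in(0,1]$, $j_S$ is integer valued, and there are a measurable $W_S:A\to[1,\infty)$ with $S_nW_S<\infty$ on $A$ for all $n$, a countable set $I_S$,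 probability measures $\nu_{S,i}\in\mathcal M(W_S)$ and non-negative, not identically zero $\eta_{S,i}\in L^\infty(W_S)$ ($i\in I_S$) with $\sum_i\eta_{S,i}\,\nu_{S,i}(W_S)\in L^\infty(W_S)$, and a sequence $\alpha_{S,n}\to 0$ such that for all $f\in L^\infty(W_S)$, $n\ge 1$, $x\in A$, $$\Big|\theta_{0,S}^{-n}n^{-j_S(x)}S_nf(x)-\sum_{i\in I_S}\eta_{S,i}(x)\nu_{S,i}(f)\Big|\le \alpha_{S,n}W_S(x)\|f\|_{W_S}.$$ **Statement.** Let $\{D_1,D_2\}$ be a measurable partition of $D$ such that $\mathbb P_x(T_{D_1}=\infty)=1$ for all $x\in D_2$. Let $(S_n)$, $(P_n)$, $(R_n)$ be the semigroups of $X$ restricted to $D$, $D_1$, $D_2$ respectively. Assume that $(P_n)$ on $D_1$ and $(R_n)$ on $D_2$ satisfy Assumption (A), that $j_{0,P}=0$, $j_{0,R}<\infty$, $\theta_{0,R}=\theta_{0,P}$, and that $\mathbb E_x(W_R(X_1))\le W_P(x)$ for all $x\in D_1$. Let $\ell_*\in\mathbb Z_+$ be the smallest $\ell$ such that, for all $x\in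 D_1$, $j_R(X_{T_{D_2}})\le\ell$ holds $\mathbb P_x$-almost surely on $\{T_{D_2}<\infty\}$. Set $W_S=W_P+W_R$, $\alpha_{P,0}=\alpha_{R,0}=1$, $$j(x)=\begin{cases}1+\ell_*&x\in D_1,\\ j_R(x)&x\in D_2,\end{cases}\qquad \eta_{i}(x)=\eta_{R,i}(x)+\frac{\theta_{0,P}^{-1}}{1+\ell_*}\sum_{k\in I_P}\eta_{P,k}(x)\,\mathbb E_{\nu_{P,k}}\big(\mathbf 1_{j_R(X_1)=\ell_*}\eta_{R,i}(X_1)\big)\quad(i\in I_R),$$ and, for a constant $C>0$, $$\alpha_{S,n}=\frac Cn\Big(\ell_*+\sum_{k=0}^n(\alpha_{P,k}+\alpha_{R,k})\Big).$$ Then $\mathbb E_x(W_S(X_n)\mathbf 1_{n<\tau_\partial})<\infty$ for all $n\ge0$ and $x\in D$, the series defining $\eta_i(x)$ and the series $\sum_{i\in I_R}\eta_i(x)\nu_{R,i}(f)$ converge for all $x\in D$ and $f\in L^\infty(W_S)$, and there is a constant $C>0$, which does not depend on $x$, $n$ and $f$, such that, for all $f\in L^\infty(W_S)$ and all $n\ge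 1$, $$\Big|\theta_{0,P}^{-n}n^{-j(x)}\,\mathbb E_x\big(f(X_n)\mathbf 1_{n<\tau_\partial}\big)-\sum_{i\in I_R}\eta_{i}(x)\,\nu_{R,i}(f)\Big|\le \alpha_{S,n}W_S(x)\|f\|_{W_S}\qquad(\ast)$$ for all $x\in D_1$. For all $x\in D_2$, the left-hand side of $(\ast)$ is at most $\alpha_{R,n}W_S(x)\|f\|_{W_S}$; and if the sequence $(\alpha_{R,n})_{n\ge 1}$ is non-increasing, then $(\ast)$ itself holds (with the same $C$) for all $x\in D$. In addition, $j_R(x)=j_S(x)=j(x)$ for all $x\in D_2$, and $j_R(x)\le j(x)$ and $j_S(x)\le j(x)$ for all $x\in D_1$ (where $j_R=0$ on $D_1$ by the extension convention). -/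

import Mathlib

open MeasureTheory ProbabilityTheory Filter Topology
open scoped ENNReal

noncomputable section

namespace ReducibleQSD

variable {E Ω : Type*} [MeasurableSpace E] [MeasurableSpace Ω]

/-- `X` is, under the probability measures `Pr x` (`x : E`), a time-homogeneous Markov chain with
one-step transition kernel `K`, started from `x`. The Markov property says that
`Pr x (X (n+1) ∈ B | X 0, …, X n) = K (X n) B` almost surely. -/
structure IsMarkovChain (K : Kernel E E) (X : ℕ → Ω → E) (Pr : E → Measure Ω) : Prop where
  prob : ∀ x, IsProbabilityMeasure (Pr x)
  meas : ∀ n, Measurable (X n)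
  start : ∀ x, (Pr x).map (X 0) = Measure.dirac x
  markov : ∀ (x : E) (n : ℕ) (s : Set Ω),
    MeasurableSet[⨆ (i : ℕ) (_ : i ≤ n), MeasurableSpace.comap (X i) inferInstance] s →
    ∀ B : Set E, MeasurableSet B →
      Pr x (s ∩ X (n + 1) ⁻¹' B) = ∫⁻ ω in s, K (X n ω) B ∂(Pr x)

/-- The hitting time `T_A = inf {n ≥ 0 : X n ∈ A}`, with `inf ∅ = ∞`. -/
def hitTime (X : ℕ → Ω → E) (A : Set E) (ω : Ω) : ℕ∞ :=
  ⨅ (n : ℕ) (_ : X n ω ∈ A), (n : ℕ∞)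

/-- The sub-Markovian semigroup of the process restricted to `A`, that is, killed when it leaves
`A`: the measure `Pr x (X n ∈ ·, n < T_{Aᶜ})`. -/
def killedLaw (X : ℕ → Ω → E) (Pr : E → Measure Ω) (A : Set E) (n : ℕ) (x : E) : Measure E :=
  ((Pr x).restrict {ω | (n : ℕ∞) < hitTime X Aᶜ ω}).map (X n)

/-- Exponential convergence parameter at the point `x` of a semigroup of measures `κ n x`:
`θ(x) = inf {θ ≥ 0 : liminf θ⁻ⁿ κ n x (1) = 0}`. -/
def expParam (κ : ℕ → E → Measure E) (x : E) : ℝ≥0∞ :=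
  sInf {θ : ℝ≥0∞ | liminf (fun n : ℕ => (θ ^ n)⁻¹ * κ n x Set.univ) atTop = 0}

/-- `θ₀ = sup_{x ∈ A} θ(x)`. -/
def expParam₀ (κ : ℕ → E → Measure E) (A : Set E) : ℝ≥0∞ :=
  ⨆ x ∈ A, expParam κ x

/-- Polynomial convergence parameter at `x` of a semigroup living on `A`:
`j(x) = inf {ℓ ≥ 0 : liminf n^(-ℓ) θ₀⁻ⁿ κ n x (1) = 0}`, with `inf ∅ = 0`
(the infimum of the empty set of reals is `0` in Mathlib). -/
def polyParam (κ : ℕ → E → Measure E) (A : Set E) (x : E) : ℝ :=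
  sInf {l : ℝ | 0 ≤ l ∧
    liminf (fun n : ℕ =>
      ENNReal.ofReal ((n : ℝ) ^ (-l)) * (expParam₀ κ A ^ n)⁻¹ * κ n x Set.univ) atTop = 0}

/-- `j₀ = sup_{x ∈ A} j(x)`, in `[0, ∞]`. -/
def polyParam₀ (κ : ℕ → E → Measure E) (A : Set E) : ℝ≥0∞ :=
  ⨆ x ∈ A, ENNReal.ofReal (polyParam κ A x)

/-- `f ∈ L^∞(W)` on the set `A`: `f` is measurable and `f / W` is bounded on `A`. -/
def MemLW (A : Set E) (W f : E → ℝ) : Prop :=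
  Measurable f ∧ BddAbove (Set.range fun x : A => |f x| / W x)

/-- The norm `‖f‖_W = sup_{x ∈ A} |f x| / W x` of `L^∞(W)`. -/
def normLW (A : Set E) (W f : E → ℝ) : ℝ :=
  ⨆ x : A, |f x| / W x

/-- Assumption (A) for a semigroup of measures `κ n x` on the set `A`, with Lyapunov function `W`,
countable index set `I`, probability measures `ν i`, functions `η i` and rate `α`.
Functions on `A` are extended by `0` outside `A`, and measures on `A` are measures on `E` that do
not charge the complement of `A`. -/
structure AssumptionA (κ : ℕ → E → Measure E) (A : Set E) {I : Type*} (W : E → ℝ)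
    (ν : I → Measure E) (η : I → E → ℝ) (α : ℕ → ℝ) : Prop where
  exp_pos : 0 < expParam₀ κ A
  exp_le_one : expParam₀ κ A ≤ 1
  poly_int : ∀ x ∈ A, ∃ k : ℕ, polyParam κ A x = k
  countable : Countable I
  W_meas : Measurable W
  W_one_le : ∀ x ∈ A, 1 ≤ W x
  W_zero : ∀ x ∉ A, W x = 0
  ν_prob : ∀ i, IsProbabilityMeasure (ν i)
  ν_supp : ∀ i, ν i Aᶜ = 0
  ν_W : ∀ i, ∫⁻ x, ENNReal.ofReal (W x) ∂(ν i) < ∞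
  η_meas : ∀ i, Measurable (η i)
  η_nonneg : ∀ i x, 0 ≤ η i x
  η_zero : ∀ i, ∀ x ∉ A, η i x = 0
  η_ne_zero : ∀ i, ∃ x ∈ A, η i x ≠ 0
  η_bdd : ∀ i, ∃ c : ℝ, ∀ x ∈ A, η i x ≤ c * W x
  sum_bdd : ∃ c : ℝ, ∀ x ∈ A,
    ∑' i, ENNReal.ofReal (η i x) * ∫⁻ y, ENNReal.ofReal (W y) ∂(ν i) ≤ ENNReal.ofReal (c * W x)
  /-- The expectations in the estimate below are finite for all `f ∈ L^∞(W)`. -/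
  W_integrable : ∀ n, ∀ x ∈ A, ∫⁻ y, ENNReal.ofReal (W y) ∂(κ n x) < ∞
  estimate : ∀ f, MemLW A W f → ∀ n : ℕ, 1 ≤ n → ∀ x ∈ A,
    |((expParam₀ κ A).toReal ^ n)⁻¹ * (n : ℝ) ^ (-polyParam κ A x) * ∫ y, f y ∂(κ n x)
        - ∑' i, η i x * ∫ y, f y ∂(ν i)| ≤ α n * W x * normLW A W f
  α_tendsto : Tendsto α atTop (𝓝 0)

/-- `𝔼_ν (g (X 1))`, where `𝔼_ν = ∫ 𝔼_x ν(dx)`. -/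
def stepMean (X : ℕ → Ω → E) (Pr : E → Measure Ω) (ν : Measure E) (g : E → ℝ) : ℝ :=
  ∫ x, ∫ ω, g (X 1 ω) ∂(Pr x) ∂ν

/-- `θ₀` for the process restricted to `A`. -/
def theta (X : ℕ → Ω → E) (Pr : E → Measure Ω) (A : Set E) : ℝ :=
  (expParam₀ (killedLaw X Pr A) A).toReal

/-- The polynomial convergence parameter `j` of the process restricted to `A`. It vanishes outside
`A`, since the killed semigroup started outside `A` is zero. -/
def jParam (X : ℕ → Ω → E) (Pr : E → Measure Ω) (A : Set E) (x : E) : ℝ :=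
  polyParam (killedLaw X Pr A) A x

/-- `l` is an almost sure upper bound, from every starting point of `D₁`, for the value of `j_R` at
the first entrance point in `D₂`. Nothing is required on the event `T_{D₂} = ∞`. -/
def EntranceBound (X : ℕ → Ω → E) (Pr : E → Measure Ω) (D₁ D₂ : Set E) (l : ℕ) : Prop :=
  ∀ x ∈ D₁, ∀ᵐ ω ∂(Pr x),
    hitTime X D₂ ω < ⊤ → jParam X Pr D₂ (X (hitTime X D₂ ω).toNat ω) ≤ l

open Classical in
/-- The exponent `j`: equal to `1 + l` on `D₁`, and to `j_R` on `D₂`. -/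
def jWeak (X : ℕ → Ω → E) (Pr : E → Measure Ω) (D₁ D₂ : Set E) (l : ℕ) (x : E) : ℝ :=
  if x ∈ D₁ then 1 + (l : ℝ) else jParam X Pr D₂ x

/-- `𝔼_ν (1_{j_R(X 1) = l} g (X 1))`. -/
def entranceMean (X : ℕ → Ω → E) (Pr : E → Measure Ω) (D₂ : Set E) (l : ℕ) (ν : Measure E)
    (g : E → ℝ) : ℝ :=
  stepMean X Pr ν ({y | jParam X Pr D₂ y = l}.indicator g)

/-- The coefficient
`η_{R,i}(x) + θ⁻¹ / (1 + l) * ∑_k η_{P,k}(x) 𝔼_{ν_{P,k}} (1_{j_R(X 1) = l} η_{R,i}(X 1))`,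
where `θ = θ_{0,P}`, for one index `i`, with `g = η_{R,i}`. -/
def etaWeak {I : Type*} (X : ℕ → Ω → E) (Pr : E → Measure Ω) (D₁ D₂ : Set E) (l : ℕ)
    (νP : I → Measure E) (ηP : I → E → ℝ) (g : E → ℝ) (x : E) : ℝ :=
  g x + (theta X Pr D₁)⁻¹ / (1 + (l : ℝ)) *
    ∑' k, ηP k x * entranceMean X Pr D₂ l (νP k) g

/-- The left-hand side of the estimate:
`|θ⁻ⁿ n^(-j(x)) 𝔼_x (f(X n) 1_{n < τ}) - ∑_i η_i(x) ν_i(f)|`, where `τ` is the hitting time of the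
cemetery point `cem`. -/
def expansionError {I : Type*} (X : ℕ → Ω → E) (Pr : E → Measure Ω) (cem : E) (θ : ℝ) (j : E → ℝ)
    (ν : I → Measure E) (η : I → E → ℝ) (n : ℕ) (x : E) (f : E → ℝ) : ℝ :=
  |(θ ^ n)⁻¹ * (n : ℝ) ^ (-j x) *
      ∫ ω in {ω | (n : ℕ∞) < hitTime X {cem} ω}, f (X n ω) ∂(Pr x)
    - ∑' i, η i x * ∫ y, f y ∂(ν i)|

/-- The rate `(C / n) * (l + ∑_{k = 0}^n (α_{P,k} + α_{R,k}))`. -/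
def alphaWeak (C : ℝ) (l : ℕ) (αP αR : ℕ → ℝ) (n : ℕ) : ℝ :=
  C / n * (l + ∑ k ∈ Finset.range (n + 1), (αP k + αR k))

end ReducibleQSD

end

open ReducibleQSD

noncomputable section

namespace ReducibleQSD

variable {E Ω : Type*} [MeasurableSpace E] [MeasurableSpace Ω]

/-! Write S, P, R for the semigroups on D₁ ∪ D₂, D₁, D₂ and θ for the common exponential parameter.
Since D₂ cannot be left for D₁, a path from D₁ crosses to D₂ at most once. Splitting over the
crossing time gives S_n = P_n + ∑_{k<n} P_k K R_{n-1-k}, with K the one-step kernel restricted to D₂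
(`killKernel_union_of_mem_left`).

Multiply by θ⁻ⁿ and put m = n-1-k. At an entrance point z, θ⁻ᵐ R_m f(z) is close to mˡ H f(z), where
H f is the limit functional of R on {j_R = l} and 0 where j_R < l: those points grow like mᵏ with k
< l, which costs a relative error 1/n (`exists_pointwise`). Integrating over the jump turns the
weight W_R into W_P, thanks to the moment hypothesis (`exists_jump_expansion`). On the D₁ side j_P =
0, so θ⁻ᵏ P_k G converges without a polynomial factor to ∑ η_P ν_P(G), where G = K H f
(`exists_left_estimate`).

The sum is thus close to θ⁻¹ (∑_{m<n} mˡ) ∑ η_P ν_P(G), and ∑_{m<n} mˡ is n^(l+1)/(l+1) up to nˡ.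
Dividing by n^(l+1) yields the exponent 1 + l and the factor θ⁻¹/(1+l); the errors add up to a
Cesàro average of α_P + α_R (`abs_average_sub_le`, `exists_left_expansion`). Exchanging the sums
over I_P and I_R identifies the coefficients η_i (`limitFun_jump_topLimit`).

From D₂ the semigroups S and R coincide, so the estimate there is that of R. The bound of order θⁿ
n^(l+1) on the mass from D₁ gives θ_{0,S} = θ and j_S ≤ 1 + l there. -/

/-! ### Hitting times and the kernels of the killed chain -/

lemma lt_hitTime_iff {E Ω : Type*} {X : ℕ → Ω → E} {B : Set E} {ω : Ω} {n : ℕ} :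
    (n : ℕ∞) < hitTime X B ω ↔ ∀ i ≤ n, X i ω ∉ B := by
  rw [← ENat.add_one_le_iff (ENat.natCast_ne_top n), hitTime, le_iInf₂_iff]
  constructor
  · intro h i hi hB
    have := h i hB
    norm_cast at this
    omega
  · intro h i hB
    have : ¬ i ≤ n := fun hi => h i hi hB
    norm_cast
    omega

lemma hitTime_eq_top_iff {E Ω : Type*} {X : ℕ → Ω → E} {B : Set E} {ω : Ω} :
    hitTime X B ω = ⊤ ↔ ∀ i, X i ω ∉ B := by
  simp [hitTime, iInf_eq_top]

/-- The `n`-step kernel of the chain with transition kernel `K` killed when it leaves `A`. -/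
def killKernel (K : Kernel E E) {A : Set E} (hA : MeasurableSet A) : ℕ → Kernel E E
  | 0 => (Kernel.id : Kernel E E).restrict hA
  | n + 1 => K.restrict hA ∘ₖ killKernel K hA n

instance (K : Kernel E E) [IsMarkovKernel K] {A : Set E} (hA : MeasurableSet A) (n : ℕ) :
    IsFiniteKernel (killKernel K hA n) := by
  induction n with
  | zero => unfold killKernel; infer_instance
  | succ n ih => unfold killKernel; infer_instance

section Chain

variable {K : Kernel E E} {X : ℕ → Ω → E} {Pr : E → Measure Ω}
  {A : Set E} (hA : MeasurableSet A)

lemma measurableSet_history {Ω : Type*} {A : Set E} (hA : MeasurableSet A) (X : ℕ → Ω → E) (n : ℕ) :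
    MeasurableSet[⨆ (i : ℕ) (_ : i ≤ n), MeasurableSpace.comap (X i) inferInstance]
      {ω | (n : ℕ∞) < hitTime X Aᶜ ω} := by
  have : {ω | (n : ℕ∞) < hitTime X Aᶜ ω} = ⋂ (i : ℕ) (_ : i ≤ n), X i ⁻¹' A := by
    ext ω; simp [lt_hitTime_iff]
  rw [this]
  refine MeasurableSet.iInter fun i => MeasurableSet.iInter fun hi => ?_
  have hle : MeasurableSpace.comap (X i) inferInstance ≤
      ⨆ (i : ℕ) (_ : i ≤ n), MeasurableSpace.comap (X i) inferInstance :=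
    le_iSup₂ (f := fun (i : ℕ) (_ : i ≤ n) =>
      MeasurableSpace.comap (X i) (inferInstance : MeasurableSpace E)) i hi
  exact hle _ ⟨A, hA, rfl⟩

/-- Survival up to time n is an event of the history, so the Markov property applies to it and gives
the recursion over the last step. This reduces the analysis of the semigroups to kernels. -/
lemma killedLaw_eq_killKernel (hX : IsMarkovChain K X Pr) (n : ℕ) (x : E) :
    killedLaw X Pr A n x = killKernel K hA n x := by
  induction n with
  | zero =>
    have h0 : {ω | ((0 : ℕ) : ℕ∞) < hitTime X Aᶜ ω} = X 0 ⁻¹' A := by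
      ext ω; rw [Set.mem_ofPred_eq, lt_hitTime_iff]; simp
    rw [killedLaw, h0, ← Measure.restrict_map (hX.meas 0) hA, hX.start x, killKernel,
      Kernel.restrict_apply, Kernel.id_apply]
  | succ n ih =>
    ext B hB
    have hs : {ω | ((n + 1 : ℕ) : ℕ∞) < hitTime X Aᶜ ω} =
        {ω | (n : ℕ∞) < hitTime X Aᶜ ω} ∩ X (n + 1) ⁻¹' A := by
      ext ω
      simp only [Set.mem_ofPred_eq, lt_hitTime_iff, Set.mem_inter_iff, Set.mem_preimage,
        Set.mem_compl_iff, not_not]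
      constructor
      · exact fun h => ⟨fun i hi => h i (by omega), h _ le_rfl⟩
      · rintro ⟨h1, h2⟩ i hi
        rcases Nat.lt_or_ge n i with h | h
        · rwa [show i = n + 1 by omega]
        · exact h1 i h
    rw [killKernel, Kernel.comp_apply' _ _ _ hB, ← ih, killedLaw, killedLaw,
      Measure.map_apply (hX.meas _) hB, Measure.restrict_apply (hX.meas _ hB), hs,
      lintegral_map (Kernel.measurable_coe _ hB) (hX.meas n)]
    have := hX.markov x n _ (measurableSet_history hA X n) (B ∩ A) (hB.inter hA)
    simp_rw [Kernel.restrict_apply' _ hA _ hB]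
    rw [← this]
    congr 1
    ext ω
    simp only [Set.mem_inter_iff, Set.mem_preimage]
    tauto

lemma killKernel_zero_apply {x : E} (hx : x ∈ A) :
    killKernel K hA 0 x = Measure.dirac x := by
  ext B hB
  rw [killKernel, Kernel.restrict_apply, Kernel.id_apply, Measure.restrict_apply hB,
    Measure.dirac_apply' _ (hB.inter hA), Measure.dirac_apply' _ hB]
  by_cases h : x ∈ B <;> simp [h, hx]

lemma killKernel_apply_of_notMem {x : E} (hx : x ∉ A) (n : ℕ) :
    killKernel K hA n x = 0 := by
  induction n with
  | zero =>
    ext B hB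
    rw [killKernel, Kernel.restrict_apply, Kernel.id_apply, Measure.restrict_apply hB,
      Measure.dirac_apply' _ (hB.inter hA)]
    simp [hx]
  | succ n ih => rw [killKernel, Kernel.comp_apply, ih, Measure.bind_zero_left]

lemma killKernel_compl (n : ℕ) (x : E) : killKernel K hA n x Aᶜ = 0 := by
  cases n with
  | zero => simp [killKernel, Kernel.restrict_apply, Measure.restrict_apply hA.compl]
  | succ n =>
    rw [killKernel, Kernel.comp_apply' _ _ _ hA.compl]
    simp [Kernel.restrict_apply, Measure.restrict_apply hA.compl]

lemma ae_killKernel (n : ℕ) (x : E) : ∀ᵐ y ∂(killKernel K hA n x), y ∈ A :=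
  mem_ae_iff.2 (killKernel_compl hA n x)

lemma map_one_eq (hX : IsMarkovChain K X Pr) (x : E) : (Pr x).map (X 1) = K x := by
  have h := killedLaw_eq_killKernel (A := Set.univ) MeasurableSet.univ hX 1 x
  have h1 : {ω | ((1 : ℕ) : ℕ∞) < hitTime X Set.univᶜ ω} = Set.univ := by
    ext ω; rw [Set.mem_ofPred_eq, lt_hitTime_iff]; simp
  rw [killedLaw, h1, Measure.restrict_univ] at h
  rw [h, killKernel, Kernel.restrict_univ, Kernel.comp_apply,
    killKernel_zero_apply _ (Set.mem_univ x), Measure.dirac_bind K.measurable]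

end Chain

/-! ### Decomposition over the crossing time from D₁ to D₂ -/

section Decomposition

variable {K : Kernel E E} {D₁ D₂ : Set E}
  (hD₁ : MeasurableSet D₁) (hD₂ : MeasurableSet D₂)

lemma lintegral_killKernel_succ {A : Set E} (hA : MeasurableSet A) (n : ℕ) (x : E)
    {g : E → ℝ≥0∞} (hg : Measurable g) :
    ∫⁻ y, g y ∂(killKernel K hA (n + 1) x) =
      ∫⁻ y, ∫⁻ z, g z ∂(K.restrict hA y) ∂(killKernel K hA n x) := by
  rw [killKernel, Kernel.lintegral_comp _ _ _ hg]

lemma lintegral_restrict_union (hdisj : Disjoint D₁ D₂) (y : E) (g : E → ℝ≥0∞) :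
    ∫⁻ z, g z ∂(K.restrict (hD₁.union hD₂) y) =
      ∫⁻ z, g z ∂(K.restrict hD₁ y) + ∫⁻ z, g z ∂(K.restrict hD₂ y) := by
  simp only [Kernel.restrict_apply]
  exact lintegral_union hD₂ hdisj

lemma lintegral_restrict_union_of_closed (hdisj : Disjoint D₁ D₂) {y : E}
    (hy : K y D₁ = 0) (g : E → ℝ≥0∞) :
    ∫⁻ z, g z ∂(K.restrict (hD₁.union hD₂) y) = ∫⁻ z, g z ∂(K.restrict hD₂ y) := by
  rw [lintegral_restrict_union hD₁ hD₂ hdisj, Kernel.restrict_apply K hD₁,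
    Measure.restrict_eq_zero.2 hy]
  simp

/-- From a point of a closed class `D₂`, killing outside `D₁ ∪ D₂` or outside `D₂` is the same. -/
lemma killKernel_union_of_mem_right (hdisj : Disjoint D₁ D₂) (hcl : ∀ y ∈ D₂, K y D₁ = 0)
    {x : E} (hx : x ∈ D₂) (n : ℕ) :
    killKernel K (hD₁.union hD₂) n x = killKernel K hD₂ n x := by
  induction n with
  | zero => rw [killKernel_zero_apply _ hx, killKernel_zero_apply _ (Set.mem_union_right _ hx)]
  | succ n ih =>
    refine Measure.ext_of_lintegral _ fun g hg => ?_
    rw [lintegral_killKernel_succ _ _ _ hg, lintegral_killKernel_succ _ _ _ hg, ih]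
    refine lintegral_congr_ae ?_
    filter_upwards [ae_killKernel (K := K) hD₂ n x] with y hy
    exact lintegral_restrict_union_of_closed hD₁ hD₂ hdisj (hcl y hy) g

/-- Induction on n by conditioning on the last step, with g arbitrary so that the hypothesis applies
to the integral of g against the killed one-step kernel. The last step from D₁ either stays there or
produces the new term k = n; in the terms k < n it merely lengthens the stay in D₂. Nonnegative
functions avoid any integrability question at this stage. -/
lemma lintegral_killKernel_union (hdisj : Disjoint D₁ D₂) (hcl : ∀ y ∈ D₂, K y D₁ = 0)
    {x : E} (hx : x ∈ D₁) (n : ℕ) {g : E → ℝ≥0∞} (hg : Measurable g) :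
    ∫⁻ y, g y ∂(killKernel K (hD₁.union hD₂) n x) =
      ∫⁻ y, g y ∂(killKernel K hD₁ n x) + ∑ k ∈ Finset.range n,
        ∫⁻ y, ∫⁻ z, ∫⁻ w, g w ∂(killKernel K hD₂ (n - 1 - k) z) ∂(K.restrict hD₂ y)
          ∂(killKernel K hD₁ k x) := by
  induction n generalizing g with
  | zero =>
    rw [killKernel_zero_apply _ hx, killKernel_zero_apply _ (Set.mem_union_left _ hx)]
    simp
  | succ n ih =>
    rw [lintegral_killKernel_succ _ _ _ hg, ih hg.lintegral_kernel, Finset.sum_range_succ,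
      lintegral_killKernel_succ _ _ _ hg]
    simp_rw [lintegral_restrict_union hD₁ hD₂ hdisj]
    rw [lintegral_add_left hg.lintegral_kernel, add_assoc, add_comm (Finset.sum _ _)]
    congr 1
    congr 1
    · refine lintegral_congr fun y => lintegral_congr_ae ?_
      have : ∀ᵐ z ∂(K.restrict hD₂ y), z ∈ D₂ := by
        rw [Kernel.restrict_apply]; exact ae_restrict_mem hD₂
      filter_upwards [this] with z hz
      rw [show n + 1 - 1 - n = 0 by omega, killKernel_zero_apply hD₂ hz, lintegral_dirac' _ hg]
    · refine Finset.sum_congr rfl fun k hk => ?_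
      have hk' := Finset.mem_range.1 hk
      refine lintegral_congr fun y => lintegral_congr fun z => ?_
      rw [show n + 1 - 1 - k = (n - 1 - k) + 1 by omega, lintegral_killKernel_succ _ _ _ hg]
      refine lintegral_congr_ae ?_
      filter_upwards [ae_killKernel (K := K) hD₂ (n - 1 - k) z] with w hw
      rw [Kernel.restrict_apply K hD₁, Measure.restrict_eq_zero.2 (hcl w hw)]
      simp

/-- Decomposition of the killed chain according to the time at which it jumps from `D₁` to `D₂`. -/
lemma killKernel_union_of_mem_left (hdisj : Disjoint D₁ D₂) (hcl : ∀ y ∈ D₂, K y D₁ = 0)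
    {x : E} (hx : x ∈ D₁) (n : ℕ) :
    killKernel K (hD₁.union hD₂) n x = killKernel K hD₁ n x + ∑ k ∈ Finset.range n,
      (killKernel K hD₂ (n - 1 - k) ∘ₖ (K.restrict hD₂ ∘ₖ killKernel K hD₁ k)) x := by
  refine Measure.ext_of_lintegral _ fun g hg => ?_
  rw [lintegral_killKernel_union hD₁ hD₂ hdisj hcl hx n hg, lintegral_add_measure,
    lintegral_finsetSum_measure]
  congr 1
  refine Finset.sum_congr rfl fun k _ => ?_
  rw [Kernel.lintegral_comp _ _ _ hg, Kernel.lintegral_comp _ _ _ hg.lintegral_kernel]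

end Decomposition

/-! ### Weighted supremum norms -/

section WeightedNorm

variable {E : Type*} [MeasurableSpace E] {A : Set E} {W f : E → ℝ}

lemma MemLW.abs_le (hf : MemLW A W f) (hW : ∀ x ∈ A, 1 ≤ W x) {x : E} (hx : x ∈ A) :
    |f x| ≤ normLW A W f * W x := by
  have h := le_ciSup hf.2 ⟨x, hx⟩
  rwa [div_le_iff₀ (zero_lt_one.trans_le (hW x hx))] at h

lemma memLW_of_abs_le (hfm : Measurable f) (hW : ∀ x ∈ A, 1 ≤ W x) {M : ℝ}
    (hf : ∀ x ∈ A, |f x| ≤ M * W x) : MemLW A W f := by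
  refine ⟨hfm, M, ?_⟩
  rintro _ ⟨x, rfl⟩
  exact (div_le_iff₀ (zero_lt_one.trans_le (hW x x.2))).2 (hf x x.2)

lemma normLW_le {E : Type*} {A : Set E} {W f : E → ℝ} (hA : A.Nonempty) (hW : ∀ x ∈ A, 1 ≤ W x) {M : ℝ}
    (hf : ∀ x ∈ A, |f x| ≤ M * W x) : normLW A W f ≤ M := by
  have : Nonempty A := hA.to_subtype
  exact ciSup_le fun x => (div_le_iff₀ (zero_lt_one.trans_le (hW x x.2))).2 (hf x x.2)

end WeightedNorm

/-! ### Exponential and polynomial parameters -/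

lemma polyParam_nonneg (κ : ℕ → E → Measure E) (A : Set E) (x : E) : 0 ≤ polyParam κ A x :=
  Real.sInf_nonneg fun _ h => h.1

/-- The quantity whose vanishing defines `polyParam`. -/
def polyLiminf (κ : ℕ → E → Measure E) (A : Set E) (q : ℝ) (x : E) : ℝ≥0∞ :=
  liminf (fun n : ℕ =>
    ENNReal.ofReal ((n : ℝ) ^ (-q)) * (expParam₀ κ A ^ n)⁻¹ * κ n x Set.univ) atTop

lemma polyParam_eq (κ : ℕ → E → Measure E) (A : Set E) (x : E) :
    polyParam κ A x = sInf {q : ℝ | 0 ≤ q ∧ polyLiminf κ A q x = 0} := rfl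

lemma polyParam_le {κ : ℕ → E → Measure E} {A : Set E} {x : E} {q : ℝ} (hq : 0 ≤ q)
    (h : polyLiminf κ A q x = 0) : polyParam κ A x ≤ q :=
  csInf_le ⟨0, fun _ h => h.1⟩ ⟨hq, h⟩

lemma polyLiminf_of_zero {κ : ℕ → E → Measure E} {A : Set E} {x : E} (h : ∀ n, κ n x = 0)
    (q : ℝ) : polyLiminf κ A q x = 0 := by
  simp [polyLiminf, h]

lemma polyParam_of_zero {κ : ℕ → E → Measure E} {A : Set E} {x : E} (h : ∀ n, κ n x = 0) :
    polyParam κ A x = 0 :=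
  le_antisymm (polyParam_le le_rfl (polyLiminf_of_zero h 0)) (polyParam_nonneg κ A x)

lemma polyLiminf_antitone (κ : ℕ → E → Measure E) (A : Set E) (x : E) :
    Antitone fun q => polyLiminf κ A q x := by
  intro p q hpq
  refine liminf_le_liminf ?_
  filter_upwards [eventually_ge_atTop 1] with n hn
  have : (n : ℝ) ^ (-q) ≤ (n : ℝ) ^ (-p) :=
    Real.rpow_le_rpow_of_exponent_le (by exact_mod_cast hn) (by linarith)
  gcongr

/-- The normalized mass is at most C n^(p-q). The inequality p < q must be strict, since q = p would
give boundedness only. -/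
lemma polyLiminf_eq_zero_of_le {κ : ℕ → E → Measure E} {A : Set E} {x : E}
    (h0 : 0 < expParam₀ κ A) (h1 : expParam₀ κ A ≤ 1) {C : ℝ} {p : ℕ}
    (hb : ∀ n : ℕ, 1 ≤ n →
      κ n x Set.univ ≤ ENNReal.ofReal (C * (expParam₀ κ A).toReal ^ n * (n : ℝ) ^ p))
    {q : ℝ} (hpq : p < q) : polyLiminf κ A q x = 0 := by
  refine Tendsto.liminf_eq ?_
  have htop : expParam₀ κ A ≠ ∞ := ne_top_of_le_ne_top ENNReal.one_ne_top h1
  set θ := (expParam₀ κ A).toReal with hθ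
  have hθpos : 0 < θ := ENNReal.toReal_pos h0.ne' htop
  have hθe : expParam₀ κ A = ENNReal.ofReal θ := (ENNReal.ofReal_toReal htop).symm
  have hlim : Tendsto (fun n : ℕ => ENNReal.ofReal (C * (n : ℝ) ^ (-(q - p)))) atTop (𝓝 0) := by
    have : Tendsto (fun n : ℕ => C * (n : ℝ) ^ (-(q - p))) atTop (𝓝 (C * 0)) :=
      ((tendsto_rpow_neg_atTop (by linarith)).comp tendsto_natCast_atTop_atTop).const_mul C
    simpa using ENNReal.tendsto_ofReal this
  refine tendsto_of_tendsto_of_tendsto_of_le_of_le' tendsto_const_nhds hlim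
    (Eventually.of_forall fun n => zero_le) ?_
  filter_upwards [eventually_ge_atTop 1] with n hn
  have hn0 : (0 : ℝ) < n := by exact_mod_cast hn
  have hpow : 0 < θ ^ n := pow_pos hθpos n
  calc _ ≤ ENNReal.ofReal ((n : ℝ) ^ (-q)) * (expParam₀ κ A ^ n)⁻¹ *
        ENNReal.ofReal (C * θ ^ n * (n : ℝ) ^ p) := by gcongr; exact hb n hn
    _ = ENNReal.ofReal (C * (n : ℝ) ^ (-(q - p))) := by
      rw [hθe, ← ENNReal.ofReal_pow hθpos.le, ← ENNReal.ofReal_inv_of_pos hpow,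
        ← ENNReal.ofReal_mul (by positivity), ← ENNReal.ofReal_mul (by positivity)]
      congr 1
      rw [show -(q - p) = -q + (p : ℝ) by ring, Real.rpow_add hn0, Real.rpow_natCast]
      field_simp

/-- For every r > Θ, the geometric factor (Θ/r)ⁿ beats nᵖ: a polynomial factor does not affect the
exponential parameter. -/
lemma expParam_le_of_le {κ : ℕ → E → Measure E} {x : E} {Θ : ℝ≥0∞} (h0 : 0 < Θ) (h1 : Θ ≤ 1)
    {C : ℝ} {p : ℕ}
    (hb : ∀ n : ℕ, 1 ≤ n → κ n x Set.univ ≤ ENNReal.ofReal (C * Θ.toReal ^ n * (n : ℝ) ^ p)) :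
    expParam κ x ≤ Θ := by
  have htop : Θ ≠ ∞ := ne_top_of_le_ne_top ENNReal.one_ne_top h1
  refine le_of_forall_gt_imp_ge_of_dense fun r hr => ?_
  rcases eq_or_ne r ∞ with rfl | hrt
  · exact le_top
  refine csInf_le' ?_
  refine Tendsto.liminf_eq ?_
  set θ := Θ.toReal with hθ
  have hθpos : 0 < θ := ENNReal.toReal_pos h0.ne' htop
  set s := r.toReal with hs
  have hrs : r = ENNReal.ofReal s := (ENNReal.ofReal_toReal hrt).symm
  have hθs : θ < s := (ENNReal.toReal_lt_toReal htop hrt).2 hr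
  have hspos : 0 < s := hθpos.trans hθs
  have hlim : Tendsto (fun n : ℕ => ENNReal.ofReal (C * ((n : ℝ) ^ p * (θ / s) ^ n)))
      atTop (𝓝 0) := by
    have hlt : |θ / s| < 1 := by
      rw [abs_of_pos (by positivity), div_lt_one hspos]; exact hθs
    have := (tendsto_pow_const_mul_const_pow_of_abs_lt_one p hlt).const_mul C
    simpa using ENNReal.tendsto_ofReal this
  refine tendsto_of_tendsto_of_tendsto_of_le_of_le' tendsto_const_nhds hlim
    (Eventually.of_forall fun n => zero_le) ?_
  filter_upwards [eventually_ge_atTop 1] with n hn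
  have hpow : 0 < s ^ n := pow_pos hspos n
  calc _ ≤ (r ^ n)⁻¹ * ENNReal.ofReal (C * θ ^ n * (n : ℝ) ^ p) := by gcongr; exact hb n hn
    _ = ENNReal.ofReal (C * ((n : ℝ) ^ p * (θ / s) ^ n)) := by
      rw [hrs, ← ENNReal.ofReal_pow hspos.le, ← ENNReal.ofReal_inv_of_pos hpow,
        ← ENNReal.ofReal_mul (by positivity)]
      congr 1
      rw [div_pow]
      field_simp

lemma measurable_polyLiminf (κ : ℕ → Kernel E E) (A : Set E) (q : ℝ) :
    Measurable (polyLiminf (fun n x => κ n x) A q) :=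
  Measurable.liminf fun n =>
    measurable_const.mul ((κ n).measurable_coe MeasurableSet.univ)

/-- By monotonicity in the exponent, a strict sublevel set is a countable union, over rational
exponents, of zero sets of measurable lower limits. The hypothesis `hne` excludes the default value
0 of the infimum of an empty set. -/
lemma measurable_polyParam (κ : ℕ → Kernel E E) (A : Set E)
    (hne : ∀ x, ∃ q, 0 ≤ q ∧ polyLiminf (fun n x => κ n x) A q x = 0) :
    Measurable (polyParam (fun n x => κ n x) A) := by
  refine measurable_of_Iio fun c => ?_
  have : polyParam (fun n x => κ n x) A ⁻¹' Set.Iio c =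
      ⋃ (q : ℚ) (_ : 0 ≤ (q : ℝ) ∧ (q : ℝ) < c),
        {x | polyLiminf (fun n x => κ n x) A q x = 0} := by
    ext x
    simp only [Set.mem_preimage, Set.mem_Iio, Set.mem_iUnion, Set.mem_ofPred_eq, exists_prop]
    constructor
    · intro h
      rw [polyParam_eq] at h
      obtain ⟨b, ⟨hb0, hb⟩, hbc⟩ := exists_lt_of_csInf_lt (hne x) h
      obtain ⟨q, hq1, hq2⟩ := exists_rat_btwn hbc
      refine ⟨q, ⟨hb0.trans hq1.le, hq2⟩, le_antisymm ?_ zero_le⟩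
      rw [← hb]
      exact polyLiminf_antitone _ A x hq1.le
    · rintro ⟨q, ⟨hq0, hqc⟩, hq⟩
      exact (polyParam_le hq0 hq).trans_lt hqc
  rw [this]
  refine MeasurableSet.iUnion fun q => MeasurableSet.iUnion fun _ => ?_
  exact measurable_polyLiminf κ A q (measurableSet_singleton 0)

/-! ### Consequences of Assumption (A) -/

/-- The limit functional `f ↦ ∑ i, η i x * ν i f` of Assumption (A). -/
def limitFun {I : Type*} (ν : I → Measure E) (η : I → E → ℝ) (f : E → ℝ) (x : E) : ℝ :=
  ∑' i, η i x * ∫ y, f y ∂(ν i)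

namespace AssumptionA

variable {κ : ℕ → E → Measure E} {A : Set E} {I : Type*} {W : E → ℝ}
  {ν : I → Measure E} {η : I → E → ℝ} {α : ℕ → ℝ}

lemma nonempty (h : AssumptionA κ A W ν η α) : A.Nonempty := by
  by_contra hA
  rw [Set.not_nonempty_iff_eq_empty] at hA
  have := h.exp_pos
  simp [expParam₀, hA] at this

lemma theta_pos (h : AssumptionA κ A W ν η α) : 0 < (expParam₀ κ A).toReal :=
  ENNReal.toReal_pos h.exp_pos.ne' (ne_top_of_le_ne_top ENNReal.one_ne_top h.exp_le_one)

lemma W_nonneg (h : AssumptionA κ A W ν η α) (x : E) : 0 ≤ W x := by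
  by_cases hx : x ∈ A
  · exact zero_le_one.trans (h.W_one_le x hx)
  · exact (h.W_zero x hx).ge

lemma W_pos (h : AssumptionA κ A W ν η α) {x : E} (hx : x ∈ A) : 0 < W x :=
  zero_lt_one.trans_le (h.W_one_le x hx)

lemma bound_nonneg (h : AssumptionA κ A W ν η α) {f : E → ℝ} {M : ℝ}
    (hf : ∀ x ∈ A, |f x| ≤ M * W x) : 0 ≤ M := by
  obtain ⟨x, hx⟩ := h.nonempty
  exact nonneg_of_mul_nonneg_left ((abs_nonneg _).trans (hf x hx)) (h.W_pos hx)

lemma abs_W_le (h : AssumptionA κ A W ν η α) (x : E) : |W x| ≤ 1 * W x := by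
  rw [abs_of_nonneg (h.W_nonneg x), one_mul]

/-- Nonnegativity is not assumed; it is read off the estimate for f = W, which has norm 1. -/
lemma α_nonneg (h : AssumptionA κ A W ν η α) {n : ℕ} (hn : 1 ≤ n) : 0 ≤ α n := by
  obtain ⟨x, hx⟩ := h.nonempty
  have hW := h.W_pos hx
  have h1 : normLW A W W = 1 := by
    have : Nonempty A := h.nonempty.to_subtype
    unfold normLW
    have : ∀ y : A, |W y| / W y = 1 := fun y => by
      rw [abs_of_pos (h.W_pos y.2), div_self (h.W_pos y.2).ne']
    simp [this]
  have := (abs_nonneg _).trans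
    (h.estimate W (memLW_of_abs_le h.W_meas h.W_one_le fun x _ => h.abs_W_le x) n hn x hx)
  rw [h1, mul_one] at this
  exact nonneg_of_mul_nonneg_left this hW

lemma exists_α_le (h : AssumptionA κ A W ν η α) : ∃ a, 0 ≤ a ∧ ∀ n, α n ≤ a := by
  obtain ⟨a, ha⟩ := h.α_tendsto.bddAbove_range
  exact ⟨max a 0, le_max_right _ _, fun n => (ha ⟨n, rfl⟩).trans (le_max_left _ _)⟩

/-- Working with any bound M instead of the norm lets the estimates be composed without computing
norms of intermediate functions. -/
lemma estimate_of_le (h : AssumptionA κ A W ν η α) {f : E → ℝ} (hfm : Measurable f) {M : ℝ}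
    (hf : ∀ x ∈ A, |f x| ≤ M * W x) {n : ℕ} (hn : 1 ≤ n) {x : E} (hx : x ∈ A) :
    |((expParam₀ κ A).toReal ^ n)⁻¹ * (n : ℝ) ^ (-polyParam κ A x) * ∫ y, f y ∂(κ n x)
        - limitFun ν η f x| ≤ α n * W x * M :=
  (h.estimate f (memLW_of_abs_le hfm h.W_one_le hf) n hn x hx).trans
    (mul_le_mul_of_nonneg_left (normLW_le h.nonempty h.W_one_le hf)
      (mul_nonneg (h.α_nonneg hn) (h.W_nonneg x)))

lemma ae_ν (h : AssumptionA κ A W ν η α) (i : I) : ∀ᵐ x ∂(ν i), x ∈ A :=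
  mem_ae_iff.2 (h.ν_supp i)

lemma integrable_W_ν (h : AssumptionA κ A W ν η α) (i : I) : Integrable W (ν i) := by
  refine ⟨h.W_meas.aestronglyMeasurable, ?_⟩
  rw [hasFiniteIntegral_iff_ofReal (ae_of_all _ h.W_nonneg)]
  exact h.ν_W i

lemma integrable_W_κ (h : AssumptionA κ A W ν η α) (n : ℕ) {x : E} (hx : x ∈ A) :
    Integrable W (κ n x) := by
  refine ⟨h.W_meas.aestronglyMeasurable, ?_⟩
  rw [hasFiniteIntegral_iff_ofReal (ae_of_all _ h.W_nonneg)]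
  exact h.W_integrable n x hx

end AssumptionA

/-- A measurable function dominated on `A` by a multiple of an integrable `W` is integrable for
every measure carried by `A`. -/
lemma integrable_of_abs_le {A : Set E} {W f : E → ℝ} {μ : Measure E} (hμ : ∀ᵐ x ∂μ, x ∈ A)
    (hW : Integrable W μ) (hfm : Measurable f) {M : ℝ} (hf : ∀ x ∈ A, |f x| ≤ M * W x) :
    Integrable f μ :=
  (hW.const_mul M).mono' hfm.aestronglyMeasurable (hμ.mono fun x hx => hf x hx)

lemma abs_integral_le_of_abs_le {A : Set E} {W f : E → ℝ} {μ : Measure E} (hμ : ∀ᵐ x ∂μ, x ∈ A)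
    (hW : Integrable W μ) {M : ℝ} (hf : ∀ x ∈ A, |f x| ≤ M * W x) :
    |∫ x, f x ∂μ| ≤ M * ∫ x, W x ∂μ := by
  rw [← integral_const_mul]
  exact norm_integral_le_of_norm_le (f := f) (hW.const_mul M) (hμ.mono fun x hx => hf x hx)

namespace AssumptionA

variable {κ : ℕ → E → Measure E} {A : Set E} {I : Type*} {W : E → ℝ}
  {ν : I → Measure E} {η : I → E → ℝ} {α : ℕ → ℝ}

lemma abs_ν_le (h : AssumptionA κ A W ν η α) {f : E → ℝ} {M : ℝ}
    (hf : ∀ x ∈ A, |f x| ≤ M * W x) (i : I) : |∫ y, f y ∂(ν i)| ≤ M * ∫ y, W y ∂(ν i) :=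
  abs_integral_le_of_abs_le (h.ae_ν i) (h.integrable_W_ν i) hf

lemma ν_W_nonneg (h : AssumptionA κ A W ν η α) (i : I) : 0 ≤ ∫ y, W y ∂(ν i) :=
  integral_nonneg h.W_nonneg

/-- The real-valued form of `sum_bdd`: finiteness in [0, ∞] yields summability, and off A both sides
vanish. Every later domination of series rests on it. -/
lemma exists_sum_W_le (h : AssumptionA κ A W ν η α) : ∃ c : ℝ, 0 ≤ c ∧ ∀ x,
    (Summable fun i => η i x * ∫ y, W y ∂(ν i)) ∧ ∑' i, η i x * ∫ y, W y ∂(ν i) ≤ c * W x := by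
  obtain ⟨c, hc⟩ := h.sum_bdd
  refine ⟨max c 0, le_max_right _ _, fun x => ?_⟩
  by_cases hx : x ∈ A
  swap
  · have : ∀ i, η i x = 0 := fun i => h.η_zero i x hx
    simp [this, h.W_zero x hx, summable_zero]
  have hterm : ∀ i, ENNReal.ofReal (η i x) * ∫⁻ y, ENNReal.ofReal (W y) ∂(ν i) =
      ENNReal.ofReal (η i x * ∫ y, W y ∂(ν i)) := fun i => by
    rw [ENNReal.ofReal_mul (h.η_nonneg i x),
      ofReal_integral_eq_lintegral_ofReal (h.integrable_W_ν i) (ae_of_all _ h.W_nonneg)]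
  have h0 : ∀ i, 0 ≤ η i x * ∫ y, W y ∂(ν i) := fun i =>
    mul_nonneg (h.η_nonneg i x) (h.ν_W_nonneg i)
  have hle := hc x hx
  simp_rw [hterm] at hle
  have hs : Summable fun i => η i x * ∫ y, W y ∂(ν i) := by
    have := ENNReal.summable_toReal (ne_top_of_le_ne_top ENNReal.ofReal_ne_top hle)
    refine this.congr fun i => ?_
    rw [ENNReal.toReal_ofReal (h0 i)]
  refine ⟨hs, ?_⟩
  rw [← ENNReal.ofReal_tsum_of_nonneg h0 hs] at hle
  have hcW : c * W x ≤ max c 0 * W x :=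
    mul_le_mul_of_nonneg_right (le_max_left _ _) (h.W_nonneg x)
  exact (ENNReal.ofReal_le_ofReal_iff
    (mul_nonneg (le_max_right _ _) (h.W_nonneg x))).1
      (hle.trans (ENNReal.ofReal_le_ofReal hcW))

lemma summable_abs_limitFun (h : AssumptionA κ A W ν η α) {f : E → ℝ} {M : ℝ}
    (hf : ∀ x ∈ A, |f x| ≤ M * W x) (x : E) :
    Summable fun i => |η i x * ∫ y, f y ∂(ν i)| := by
  obtain ⟨c, -, hc⟩ := h.exists_sum_W_le
  refine Summable.of_nonneg_of_le (fun i => abs_nonneg _) (fun i => ?_) ((hc x).1.mul_left M)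
  rw [abs_mul, abs_of_nonneg (h.η_nonneg i x)]
  calc _ ≤ η i x * (M * ∫ y, W y ∂(ν i)) :=
        mul_le_mul_of_nonneg_left (h.abs_ν_le hf i) (h.η_nonneg i x)
    _ = _ := by ring

lemma exists_abs_limitFun_le (h : AssumptionA κ A W ν η α) : ∃ c : ℝ, 0 ≤ c ∧
    ∀ (f : E → ℝ) (M : ℝ), (∀ x ∈ A, |f x| ≤ M * W x) → ∀ x,
      ∑' i, |η i x * ∫ y, f y ∂(ν i)| ≤ c * W x * M := by
  obtain ⟨c, hc0, hc⟩ := h.exists_sum_W_le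
  refine ⟨c, hc0, fun f M hf x => ?_⟩
  have hM := h.bound_nonneg hf
  calc ∑' i, |η i x * ∫ y, f y ∂(ν i)| ≤ ∑' i, M * (η i x * ∫ y, W y ∂(ν i)) := by
        refine (h.summable_abs_limitFun hf x).tsum_le_tsum (fun i => ?_) ((hc x).1.mul_left M)
        rw [abs_mul, abs_of_nonneg (h.η_nonneg i x)]
        calc _ ≤ η i x * (M * ∫ y, W y ∂(ν i)) :=
              mul_le_mul_of_nonneg_left (h.abs_ν_le hf i) (h.η_nonneg i x)
          _ = _ := by ring
    _ = M * ∑' i, η i x * ∫ y, W y ∂(ν i) := tsum_mul_left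
    _ ≤ M * (c * W x) := mul_le_mul_of_nonneg_left (hc x).2 hM
    _ = c * W x * M := by ring

lemma abs_limitFun_le_tsum (h : AssumptionA κ A W ν η α) {f : E → ℝ} {M : ℝ}
    (hf : ∀ x ∈ A, |f x| ≤ M * W x) (x : E) :
    |limitFun ν η f x| ≤ ∑' i, |η i x * ∫ y, f y ∂(ν i)| :=
  norm_tsum_le_tsum_norm (f := fun i => η i x * ∫ y, f y ∂(ν i)) (h.summable_abs_limitFun hf x)

lemma measurable_limitFun (h : AssumptionA κ A W ν η α) {f : E → ℝ} {M : ℝ}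
    (hf : ∀ x ∈ A, |f x| ≤ M * W x) : Measurable (limitFun ν η f) := by
  have := h.countable
  -- Countability of I makes the filter of finite subsets countably generated, so a pointwise limit
  -- along it is measurable.
  refine measurable_of_tendsto_metrizable' (u := (atTop : Filter (Finset I)))
    (f := fun s x => ∑ i ∈ s, η i x * ∫ y, f y ∂(ν i)) (fun s => ?_) ?_
  · exact Finset.measurable_fun_sum s fun i _ => (h.η_meas i).mul_const _
  · exact tendsto_pi_nhds.2 fun x => (h.summable_abs_limitFun hf x).of_abs.hasSum

/-- Growth of the semigroup: `κ n x f` is at most a constant times `θ₀ⁿ n^(j x) W x ‖f‖`. -/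
lemma exists_growth (h : AssumptionA κ A W ν η α) : ∃ c : ℝ, 0 ≤ c ∧
    ∀ (f : E → ℝ), Measurable f → ∀ M : ℝ, (∀ x ∈ A, |f x| ≤ M * W x) → ∀ n : ℕ, 1 ≤ n →
      ∀ x ∈ A, |((expParam₀ κ A).toReal ^ n)⁻¹ * (n : ℝ) ^ (-polyParam κ A x) *
        ∫ y, f y ∂(κ n x)| ≤ c * W x * M := by
  obtain ⟨c, hc0, hc⟩ := h.exists_abs_limitFun_le
  obtain ⟨a, ha0, ha⟩ := h.exists_α_le
  refine ⟨a + c, by positivity, fun f hfm M hf n hn x hx => ?_⟩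
  have hM := h.bound_nonneg hf
  have h1 := h.estimate_of_le hfm hf hn hx
  have h2 := (h.abs_limitFun_le_tsum hf x).trans (hc f M hf x)
  have h3 : α n * W x * M ≤ a * W x * M :=
    mul_le_mul_of_nonneg_right (mul_le_mul_of_nonneg_right (ha n) (h.W_nonneg x)) hM
  calc _ ≤ _ := abs_sub_le_iff.1 (abs_abs_sub_abs_le_abs_sub _ (limitFun ν η f x)) |>.1 |>
        fun h => (sub_le_iff_le_add.1 h)
    _ ≤ a * W x * M + c * W x * M := add_le_add (h1.trans h3) h2
    _ = _ := by ring

lemma exists_mass_le (h : AssumptionA κ A W ν η α) (hfin : ∀ n x, IsFiniteMeasure (κ n x))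
    {x : E} (hx : x ∈ A) {k : ℕ} (hk : polyParam κ A x = k) : ∃ C : ℝ, ∀ n : ℕ, 1 ≤ n →
      κ n x Set.univ ≤ ENNReal.ofReal (C * (expParam₀ κ A).toReal ^ n * (n : ℝ) ^ k) := by
  obtain ⟨c, hc0, hc⟩ := h.exists_growth
  refine ⟨c * W x, fun n hn => ?_⟩
  have := hfin n x
  have hn0 : (0 : ℝ) < n := by exact_mod_cast hn
  have hb := hc (fun _ => 1) measurable_const 1
    (fun y hy => by simpa using h.W_one_le y hy) n hn x hx
  have hθ := pow_pos h.theta_pos n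
  rw [integral_const, smul_eq_mul, mul_one, mul_one, hk, Real.rpow_neg hn0.le,
    Real.rpow_natCast, abs_of_nonneg (by positivity)] at hb
  rw [← ofReal_measureReal]
  refine ENNReal.ofReal_le_ofReal ?_
  have := mul_le_mul_of_nonneg_right hb
    (show 0 ≤ (expParam₀ κ A).toReal ^ n * (n : ℝ) ^ k by positivity)
  calc _ = _ := ?_
    _ ≤ _ := this
    _ = _ := by ring
  field_simp

end AssumptionA

lemma AssumptionA.measurable_polyParam {κ : ℕ → Kernel E E} {A : Set E} {I : Type*} {W : E → ℝ}
    {ν : I → Measure E} {η : I → E → ℝ} {α : ℕ → ℝ}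
    (h : AssumptionA (fun n x => κ n x) A W ν η α) (hfin : ∀ n, IsFiniteKernel (κ n))
    (hz : ∀ n, ∀ x ∉ A, κ n x = 0) : Measurable (polyParam (fun n x => κ n x) A) := by
  refine ReducibleQSD.measurable_polyParam κ A fun x => ?_
  by_cases hx : x ∈ A
  · obtain ⟨k, hk⟩ := h.poly_int x hx
    obtain ⟨C, hC⟩ := h.exists_mass_le (fun n x => inferInstance) hx hk
    exact ⟨k + 1, by positivity, polyLiminf_eq_zero_of_le h.exp_pos h.exp_le_one hC (by linarith)⟩
  · exact ⟨0, le_rfl, polyLiminf_of_zero (fun n => hz n x hx) 0⟩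

/-! ### Power sums and the averaging argument -/

lemma sub_pow_le_mul_pow {x y : ℝ} (hy : 0 ≤ y) (hyx : y ≤ x) (l : ℕ) :
    (l + 1) * y ^ l * (x - y) ≤ x ^ (l + 1) - y ^ (l + 1) ∧
      x ^ (l + 1) - y ^ (l + 1) ≤ (l + 1) * x ^ l * (x - y) := by
  have hx := hy.trans hyx
  have hxy : 0 ≤ x - y := sub_nonneg.2 hyx
  have hcard : ∀ c : ℝ, ∑ _i ∈ Finset.range (l + 1), c = (l + 1) * c := fun c => by simp
  have hsplit : ∀ i ∈ Finset.range (l + 1), ∀ c : ℝ, c ^ l = c ^ i * c ^ (l + 1 - 1 - i) := by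
    intro i hi c
    rw [← pow_add]
    congr 1
    have := Finset.mem_range.1 hi
    omega
  rw [← geom_sum₂_mul x y (l + 1), ← hcard, ← hcard]
  refine ⟨mul_le_mul_of_nonneg_right (Finset.sum_le_sum fun i hi => ?_) hxy,
    mul_le_mul_of_nonneg_right (Finset.sum_le_sum fun i hi => ?_) hxy⟩
  · rw [hsplit i hi y]; gcongr
  · rw [hsplit i hi x]; gcongr

/-- Comparison of a Riemann sum with its integral: each increment of x^(l+1)/(l+1) over [n, n+1]
lies between nˡ and (n+1)ˡ, and these bounds telescope. -/
lemma abs_sum_pow_sub_le (l n : ℕ) :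
    |∑ m ∈ Finset.range n, (m : ℝ) ^ l - (n : ℝ) ^ (l + 1) / (l + 1)| ≤ (n : ℝ) ^ l := by
  have hl : (0 : ℝ) < l + 1 := by positivity
  have key : (n : ℝ) ^ (l + 1) / (l + 1) - (n : ℝ) ^ l ≤ ∑ m ∈ Finset.range n, (m : ℝ) ^ l ∧
      ∑ m ∈ Finset.range n, (m : ℝ) ^ l ≤ (n : ℝ) ^ (l + 1) / (l + 1) := by
    induction n with
    | zero => simp
    | succ n ih =>
      obtain ⟨h1, h2⟩ := sub_pow_le_mul_pow (x := (n : ℝ) + 1) (y := n) n.cast_nonneg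
        (by linarith) l
      rw [add_sub_cancel_left, mul_one] at h1 h2
      have h1' : (n : ℝ) ^ l ≤ (((n : ℝ) + 1) ^ (l + 1) - (n : ℝ) ^ (l + 1)) / (l + 1) := by
        rw [le_div_iff₀ hl]; linarith
      have h2' : (((n : ℝ) + 1) ^ (l + 1) - (n : ℝ) ^ (l + 1)) / (l + 1) ≤ ((n : ℝ) + 1) ^ l := by
        rw [div_le_iff₀ hl]; linarith
      rw [sub_div] at h1' h2'
      rw [Finset.sum_range_succ]
      push_cast
      constructor <;> linarith [ih.1, ih.2]
  have : (0 : ℝ) ≤ (n : ℝ) ^ l := by positivity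
  rw [abs_le]
  constructor <;> linarith [key.1, key.2]

/-- The averaging argument: a convolution of the weights `m ^ l` with a convergent sequence `u`,
divided by `n ^ (l + 1)`, is close to `L / (l + 1)`. -/
lemma abs_average_sub_le {θ w L B C₁ C₂ C₃ C₄ : ℝ} {l n : ℕ} {a u αP αR : ℕ → ℝ}
    (hθ : 0 < θ) (hn : 1 ≤ n) (hw : 0 ≤ w) (hC₁ : 0 ≤ C₁) (hC₂ : 0 ≤ C₂) (hC₃ : 0 ≤ C₃)
    (hC₄ : 0 ≤ C₄) (hP : ∀ k, 0 ≤ αP k) (hR : ∀ k, 0 ≤ αR k) (hP0 : αP 0 = 1)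
    (ha : ∀ k < n, |a k - ((n - 1 - k : ℕ) : ℝ) ^ l * u k| ≤
      C₁ * (n : ℝ) ^ l * (αR (n - 1 - k) + 1 / n) * w)
    (hu : ∀ k, |u k - L| ≤ C₂ * αP k * w) (hL : |L| ≤ C₃ * w) (hB : |B| ≤ C₄ * w) :
    |((n : ℝ) ^ (l + 1))⁻¹ * (B + θ⁻¹ * ∑ k ∈ Finset.range n, a k) - θ⁻¹ / (1 + l) * L| ≤
      (C₄ + θ⁻¹ * (2 * C₁ + C₂ + C₃)) / n * (∑ k ∈ Finset.range (n + 1), (αP k + αR k)) * w := by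
  have hn0 : (0 : ℝ) < n := by exact_mod_cast hn
  have hn1 : (1 : ℝ) ≤ n := by exact_mod_cast hn
  set S := ∑ k ∈ Finset.range (n + 1), (αP k + αR k) with hS
  have hSP : ∑ k ∈ Finset.range n, αP k ≤ S := by
    rw [hS, Finset.sum_range_succ]
    have : ∑ k ∈ Finset.range n, αP k ≤ ∑ k ∈ Finset.range n, (αP k + αR k) :=
      Finset.sum_le_sum fun k _ => by linarith [hR k]
    linarith [hP n, hR n]
  have hSR : ∑ k ∈ Finset.range n, αR k ≤ S := by
    rw [hS, Finset.sum_range_succ]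
    have : ∑ k ∈ Finset.range n, αR k ≤ ∑ k ∈ Finset.range n, (αP k + αR k) :=
      Finset.sum_le_sum fun k _ => by linarith [hP k]
    linarith [hP n, hR n]
  -- The convention αP 0 = 1 keeps S away from 0, so that errors of order nˡ, such as that of the
  -- power sum, are absorbed into nˡ S.
  have hS1 : 1 ≤ S := by
    calc (1 : ℝ) = αP 0 := hP0.symm
      _ ≤ ∑ k ∈ Finset.range n, αP k :=
        Finset.single_le_sum (fun k _ => hP k) (Finset.mem_range.2 hn)
      _ ≤ S := hSP
  have hpow : (0 : ℝ) < (n : ℝ) ^ l := by positivity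
  -- Three replacements follow: a k by mˡ u k, then u k by L, then the power sum by n^(l+1)/(l+1).
  -- In the first, the n errors 1/n add up to 1 ≤ S, whence the factor 2.
  have hsum_a : |∑ k ∈ Finset.range n, a k - ∑ k ∈ Finset.range n, ((n - 1 - k : ℕ) : ℝ) ^ l * u k|
      ≤ (n : ℝ) ^ l * (2 * C₁ * S * w) := by
    rw [← Finset.sum_sub_distrib]
    calc _ ≤ ∑ k ∈ Finset.range n, C₁ * (n : ℝ) ^ l * (αR (n - 1 - k) + 1 / n) * w :=
          (Finset.abs_sum_le_sum_abs _ _).trans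
            (Finset.sum_le_sum fun k hk => ha k (Finset.mem_range.1 hk))
      _ = (n : ℝ) ^ l * (C₁ * (∑ k ∈ Finset.range n, αR k + 1) * w) := by
          rw [← Finset.sum_mul, ← Finset.mul_sum, Finset.sum_add_distrib,
            Finset.sum_range_reflect (fun k => αR k) n]
          simp only [Finset.sum_const, Finset.card_range, nsmul_eq_mul]
          field_simp
      _ ≤ (n : ℝ) ^ l * (C₁ * (S + S) * w) := by gcongr
      _ = _ := by ring
  have hsum_u : |∑ k ∈ Finset.range n, ((n - 1 - k : ℕ) : ℝ) ^ l * u k -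
      (∑ m ∈ Finset.range n, (m : ℝ) ^ l) * L| ≤ (n : ℝ) ^ l * (C₂ * S * w) := by
    rw [← Finset.sum_range_reflect (fun m => (m : ℝ) ^ l) n, Finset.sum_mul,
      ← Finset.sum_sub_distrib]
    calc _ ≤ ∑ k ∈ Finset.range n, (n : ℝ) ^ l * (C₂ * αP k * w) := by
          refine (Finset.abs_sum_le_sum_abs _ _).trans (Finset.sum_le_sum fun k _ => ?_)
          rw [← mul_sub, abs_mul, abs_of_nonneg (by positivity : (0 : ℝ) ≤ ((n - 1 - k : ℕ) : ℝ) ^ l)]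
          refine mul_le_mul ?_ (hu k) (abs_nonneg _) hpow.le
          have : ((n - 1 - k : ℕ) : ℝ) ≤ n := by exact_mod_cast (by omega)
          gcongr
      _ = (n : ℝ) ^ l * (C₂ * (∑ k ∈ Finset.range n, αP k) * w) := by
          rw [← Finset.mul_sum, ← Finset.sum_mul, ← Finset.mul_sum]
      _ ≤ _ := by gcongr
  have hsum_L : |(∑ m ∈ Finset.range n, (m : ℝ) ^ l) * L - (n : ℝ) ^ (l + 1) / (l + 1) * L| ≤
      (n : ℝ) ^ l * (C₃ * S * w) := by
    rw [← sub_mul, abs_mul]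
    calc _ ≤ (n : ℝ) ^ l * (C₃ * 1 * w) := by
          rw [mul_one]
          exact mul_le_mul (abs_sum_pow_sub_le l n) hL (abs_nonneg _) hpow.le
      _ ≤ _ := by gcongr
  have htot : |∑ k ∈ Finset.range n, a k - (n : ℝ) ^ (l + 1) / (l + 1) * L| ≤
      (n : ℝ) ^ l * ((2 * C₁ + C₂ + C₃) * S * w) := by
    have h1 := abs_sub_le (∑ k ∈ Finset.range n, a k)
      (∑ k ∈ Finset.range n, ((n - 1 - k : ℕ) : ℝ) ^ l * u k) ((n : ℝ) ^ (l + 1) / (l + 1) * L)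
    have h2 := abs_sub_le (∑ k ∈ Finset.range n, ((n - 1 - k : ℕ) : ℝ) ^ l * u k)
      ((∑ m ∈ Finset.range n, (m : ℝ) ^ l) * L) ((n : ℝ) ^ (l + 1) / (l + 1) * L)
    have h3 : (n : ℝ) ^ l * ((2 * C₁ + C₂ + C₃) * S * w) = (n : ℝ) ^ l * (2 * C₁ * S * w) +
      (n : ℝ) ^ l * (C₂ * S * w) + (n : ℝ) ^ l * (C₃ * S * w) := by ring
    linarith
  have hl1 : (0 : ℝ) < l + 1 := by positivity
  have hid : ((n : ℝ) ^ (l + 1))⁻¹ * (B + θ⁻¹ * ∑ k ∈ Finset.range n, a k) - θ⁻¹ / (1 + l) * L =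
      ((n : ℝ) ^ (l + 1))⁻¹ * B + ((n : ℝ) ^ (l + 1))⁻¹ * θ⁻¹ *
        (∑ k ∈ Finset.range n, a k - (n : ℝ) ^ (l + 1) / (l + 1) * L) := by
    rw [add_comm (1 : ℝ)]
    field_simp
    ring
  rw [hid]
  have hθi : 0 < θ⁻¹ := inv_pos.2 hθ
  calc _ ≤ ((n : ℝ) ^ (l + 1))⁻¹ * |B| + ((n : ℝ) ^ (l + 1))⁻¹ * θ⁻¹ *
        |∑ k ∈ Finset.range n, a k - (n : ℝ) ^ (l + 1) / (l + 1) * L| := by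
        refine (abs_add_le _ _).trans (add_le_add ?_ ?_)
        · rw [abs_mul, abs_of_nonneg (by positivity : (0 : ℝ) ≤ ((n : ℝ) ^ (l + 1))⁻¹)]
        · rw [abs_mul, abs_of_nonneg (by positivity : (0 : ℝ) ≤ ((n : ℝ) ^ (l + 1))⁻¹ * θ⁻¹)]
    _ ≤ ((n : ℝ) ^ (l + 1))⁻¹ * ((n : ℝ) ^ l * (C₄ * S * w)) + ((n : ℝ) ^ (l + 1))⁻¹ * θ⁻¹ *
        ((n : ℝ) ^ l * ((2 * C₁ + C₂ + C₃) * S * w)) := by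
        have : |B| ≤ (n : ℝ) ^ l * (C₄ * S * w) := by
          calc |B| ≤ 1 * (C₄ * 1 * w) := by linarith
            _ ≤ _ := by gcongr; exact one_le_pow₀ hn1
        gcongr
    _ = _ := by
        rw [pow_succ]
        field_simp

lemma abs_integral_sub_integral_le {μ : Measure E} {W u v : E → ℝ} {b : ℝ} (hW : Integrable W μ)
    (hu : Integrable u μ) (hv : Integrable v μ) (h : ∀ᵐ x ∂μ, |u x - v x| ≤ b * W x) :
    |∫ x, u x ∂μ - ∫ x, v x ∂μ| ≤ b * ∫ x, W x ∂μ := by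
  rw [← integral_sub hu hv, ← integral_const_mul]
  exact norm_integral_le_of_norm_le (f := fun x => u x - v x) (hW.const_mul b) h

/-! ### The reducible setting in terms of kernels -/

/-- The restriction of `limitFun` to the points of maximal polynomial exponent. -/
def topLimit {I : Type*} (j : E → ℝ) (l : ℕ) (ν : I → Measure E) (η : I → E → ℝ) (f : E → ℝ) :
    E → ℝ :=
  {y | j y = l}.indicator (limitFun ν η f)

/-- The hypotheses on a chain with kernel `K` that moves from `D₁` to a closed set `D₂`, in terms
of the kernel only. -/
structure ReducibleSetting (K : Kernel E E) {D₁ D₂ : Set E} (hD₁ : MeasurableSet D₁)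
    (hD₂ : MeasurableSet D₂) {IP IR : Type*} (WP WR : E → ℝ) (νP : IP → Measure E)
    (νR : IR → Measure E) (ηP : IP → E → ℝ) (ηR : IR → E → ℝ) (αP αR : ℕ → ℝ) (l : ℕ) :
    Prop where
  disjoint : Disjoint D₁ D₂
  closed : ∀ y ∈ D₂, K y D₁ = 0
  left : AssumptionA (fun n x => killKernel K hD₁ n x) D₁ WP νP ηP αP
  right : AssumptionA (fun n x => killKernel K hD₂ n x) D₂ WR νR ηR αR
  alpha_left : αP 0 = 1
  alpha_right : αR 0 = 1
  poly_left : ∀ x ∈ D₁, polyParam (fun n x => killKernel K hD₁ n x) D₁ x = 0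
  expParam_eq : expParam₀ (fun n x => killKernel K hD₂ n x) D₂ =
    expParam₀ (fun n x => killKernel K hD₁ n x) D₁
  jump : ∀ y ∈ D₁, ∫⁻ z, ENNReal.ofReal (WR z) ∂(K y) ≤ ENNReal.ofReal (WP y)
  entrance : ∀ y ∈ D₁, ∀ᵐ z ∂(K.restrict hD₂ y),
    polyParam (fun n x => killKernel K hD₂ n x) D₂ z ≤ l

/-- The law, on the event that the chain jumps into `D₂`, after one step started from `ν`. -/
def jumpLaw (K : Kernel E E) {D₂ : Set E} (hD₂ : MeasurableSet D₂) (ν : Measure E) : Measure E :=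
  ν.bind (K.restrict hD₂)

/-- The integral of `g` over the entrance points in `D₂` with exponent `l`, started from `ν`. -/
def entranceCoef (K : Kernel E E) {D₂ : Set E} (hD₂ : MeasurableSet D₂) (l : ℕ) (ν : Measure E)
    (g : E → ℝ) : ℝ :=
  ∫ z, Set.indicator {y | polyParam (fun n x => killKernel K hD₂ n x) D₂ y = l} g z
    ∂(jumpLaw K hD₂ ν)

namespace ReducibleSetting

variable {K : Kernel E E} {D₁ D₂ : Set E} {hD₁ : MeasurableSet D₁}
  {hD₂ : MeasurableSet D₂} {IP IR : Type*} {WP WR : E → ℝ} {νP : IP → Measure E}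
  {νR : IR → Measure E} {ηP : IP → E → ℝ} {ηR : IR → E → ℝ} {αP αR : ℕ → ℝ} {l : ℕ}

/-- The polynomial exponent of the chain restricted to `D₂`. -/
local notation "jRk" => polyParam (fun n x => killKernel K hD₂ n x) D₂

/-- The common exponential parameter. -/
local notation "θk" => ENNReal.toReal (expParam₀ (fun n x => killKernel K hD₁ n x) D₁)

/-- The limit profile at the entrance point. -/
local notation "Hk" => topLimit (polyParam (fun n x => killKernel K hD₂ n x) D₂) l νR ηR

lemma αP_nonneg (h : ReducibleSetting K hD₁ hD₂ WP WR νP νR ηP ηR αP αR l) (k : ℕ) :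
    0 ≤ αP k := by
  rcases Nat.eq_zero_or_pos k with rfl | hk
  · rw [h.alpha_left]; exact zero_le_one
  · exact h.left.α_nonneg hk

lemma αR_nonneg (h : ReducibleSetting K hD₁ hD₂ WP WR νP νR ηP ηR αP αR l) (k : ℕ) :
    0 ≤ αR k := by
  rcases Nat.eq_zero_or_pos k with rfl | hk
  · rw [h.alpha_right]; exact zero_le_one
  · exact h.right.α_nonneg hk

lemma ae_jump (y : E) : ∀ᵐ z ∂(K.restrict hD₂ y), z ∈ D₂ := by
  rw [Kernel.restrict_apply]; exact ae_restrict_mem hD₂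

lemma measurable_jR [IsMarkovKernel K]
    (h : ReducibleSetting K hD₁ hD₂ WP WR νP νR ηP ηR αP αR l) :
    Measurable jRk :=
  h.right.measurable_polyParam (fun _ => inferInstance)
    fun n _ hx => killKernel_apply_of_notMem hD₂ hx n

lemma lintegral_jump_le (h : ReducibleSetting K hD₁ hD₂ WP WR νP νR ηP ηR αP αR l) {y : E}
    (hy : y ∈ D₁) : ∫⁻ z, ENNReal.ofReal (WR z) ∂(K.restrict hD₂ y) ≤ ENNReal.ofReal (WP y) := by
  rw [Kernel.restrict_apply]
  exact (setLIntegral_le_lintegral _ _).trans (h.jump y hy)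

lemma integrable_jump (h : ReducibleSetting K hD₁ hD₂ WP WR νP νR ηP ηR αP αR l) {y : E}
    (hy : y ∈ D₁) : Integrable WR (K.restrict hD₂ y) := by
  refine ⟨h.right.W_meas.aestronglyMeasurable, ?_⟩
  rw [hasFiniteIntegral_iff_ofReal (ae_of_all _ h.right.W_nonneg)]
  exact (h.lintegral_jump_le hy).trans_lt ENNReal.ofReal_lt_top

lemma integral_jump_le (h : ReducibleSetting K hD₁ hD₂ WP WR νP νR ηP ηR αP αR l) {y : E}
    (hy : y ∈ D₁) : ∫ z, WR z ∂(K.restrict hD₂ y) ≤ WP y := by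
  rw [integral_eq_lintegral_of_nonneg_ae (ae_of_all _ h.right.W_nonneg)
    h.right.W_meas.aestronglyMeasurable]
  exact ENNReal.toReal_le_of_le_ofReal (h.left.W_nonneg y) (h.lintegral_jump_le hy)

lemma measurable_topLimit [IsMarkovKernel K]
    (h : ReducibleSetting K hD₁ hD₂ WP WR νP νR ηP ηR αP αR l)
    {f : E → ℝ} {M : ℝ} (hf : ∀ x ∈ D₂, |f x| ≤ M * WR x) : Measurable (Hk f) :=
  (h.right.measurable_limitFun hf).indicator (h.measurable_jR (measurableSet_singleton (l : ℝ)))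

lemma exists_abs_topLimit_le (h : ReducibleSetting K hD₁ hD₂ WP WR νP νR ηP ηR αP αR l) :
    ∃ c : ℝ, 0 ≤ c ∧ ∀ (f : E → ℝ) (M : ℝ), (∀ x ∈ D₂, |f x| ≤ M * WR x) → ∀ x,
      |Hk f x| ≤ c * M * WR x := by
  obtain ⟨c, hc0, hc⟩ := h.right.exists_abs_limitFun_le
  refine ⟨c, hc0, fun f M hf x => ?_⟩
  have h1 := (h.right.abs_limitFun_le_tsum hf x).trans (hc f M hf x)
  calc |Hk f x| ≤ |limitFun νR ηR f x| := by
        by_cases hx : x ∈ {y | jRk y = l}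
        · rw [topLimit, Set.indicator_of_mem hx]
        · rw [topLimit, Set.indicator_of_notMem hx, abs_zero]; exact abs_nonneg _
    _ ≤ c * WR x * M := h1
    _ = _ := by ring

/-- Expansion of the semigroup on `D₂` at the order given by the maximal exponent `l`. -/
lemma exists_pointwise [IsMarkovKernel K]
    (h : ReducibleSetting K hD₁ hD₂ WP WR νP νR ηP ηR αP αR l) :
    ∃ C : ℝ, 0 ≤ C ∧ ∀ (f : E → ℝ), Measurable f → ∀ M : ℝ, (∀ x ∈ D₂, |f x| ≤ M * WR x) →
      ∀ n m : ℕ, m < n → ∀ z ∈ D₂, jRk z ≤ l →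
        |(θk ^ m)⁻¹ * ∫ w, f w ∂(killKernel K hD₂ m z) - (m : ℝ) ^ l * Hk f z| ≤
          C * (n : ℝ) ^ l * (αR m + 1 / n) * M * WR z := by
  obtain ⟨cg, hcg0, hcg⟩ := h.right.exists_growth
  obtain ⟨cl, hcl0, hcl⟩ := h.exists_abs_topLimit_le
  -- The term 1 serves time 0 and exponent l, cg serves exponents below l, and cl bounds the limit
  -- profile at time 0.
  refine ⟨1 + cg + cl, by positivity, fun f hfm M hf n m hmn z hz hjz => ?_⟩
  have hM := h.right.bound_nonneg hf
  have hW := h.right.W_nonneg z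
  have hn1 : (1 : ℝ) ≤ n := by exact_mod_cast (by omega : 1 ≤ n)
  have hn0 : (0 : ℝ) < n := zero_lt_one.trans_le hn1
  have hα := h.αR_nonneg m
  have hmn' : (m : ℝ) ≤ n := by exact_mod_cast hmn.le
  -- Assumption (A) says nothing at time 0; there αR 0 = 1 allows a crude bound. The power 0ˡ may
  -- equal 1, when l = 0.
  rcases Nat.eq_zero_or_pos m with rfl | hm
  · rw [killKernel_zero_apply hD₂ hz, integral_dirac' _ _ hfm.stronglyMeasurable, pow_zero,
      inv_one, one_mul, h.alpha_right]
    have hp : |((0 : ℕ) : ℝ) ^ l| ≤ 1 := by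
      rw [abs_of_nonneg (by positivity)]
      exact pow_le_one₀ (by simp) (by simp)
    have hpn : (1 : ℝ) ≤ (n : ℝ) ^ l := one_le_pow₀ hn1
    calc _ ≤ |f z| + |((0 : ℕ) : ℝ) ^ l * Hk f z| := abs_sub _ _
      _ ≤ M * WR z + 1 * (cl * M * WR z) := by
        rw [abs_mul]
        exact add_le_add (hf z hz) (mul_le_mul hp (hcl f M hf z) (abs_nonneg _) zero_le_one)
      _ = (1 + 0 + cl) * 1 * (1 + 0) * M * WR z := by ring
      _ ≤ _ := by gcongr; positivity
  have hm0 : (0 : ℝ) < m := by exact_mod_cast hm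
  obtain ⟨k, hk⟩ := h.right.poly_int z hz
  have hkl : k ≤ l := by rw [hk] at hjz; exact_mod_cast hjz
  have hrpow : (m : ℝ) ^ (-jRk z) = ((m : ℝ) ^ k)⁻¹ := by
    rw [hk, Real.rpow_neg hm0.le, Real.rpow_natCast]
  rcases hkl.eq_or_lt with heq | hlt
  · have hH : Hk f z = limitFun νR ηR f z := Set.indicator_of_mem (show z ∈ {y | jRk y = l} by rw [← heq]; exact hk) _
    have he := h.right.estimate_of_le hfm hf hm hz
    rw [hrpow, h.expParam_eq, heq] at he
    have hid : (θk ^ m)⁻¹ * ∫ w, f w ∂(killKernel K hD₂ m z) - (m : ℝ) ^ l * Hk f z =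
        (m : ℝ) ^ l * ((θk ^ m)⁻¹ * ((m : ℝ) ^ l)⁻¹ * ∫ w, f w ∂(killKernel K hD₂ m z)
          - limitFun νR ηR f z) := by
      rw [hH]; field_simp
    rw [hid, abs_mul, abs_of_nonneg (by positivity : (0 : ℝ) ≤ (m : ℝ) ^ l)]
    calc _ ≤ (m : ℝ) ^ l * (αR m * WR z * M) := by gcongr
      _ = (1 + 0 + 0) * (m : ℝ) ^ l * (αR m + 0) * M * WR z := by ring
      _ ≤ _ := by gcongr; positivity
  -- Below the maximal exponent the profile vanishes, and k + 1 ≤ l gives mᵏ ≤ nˡ/n: this is the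
  -- origin of the term 1/n.
  · have hne : z ∉ {y | jRk y = l} := by
      intro hz'
      have : (k : ℝ) = l := hk.symm.trans hz'
      exact hlt.ne (by exact_mod_cast this)
    have hH : Hk f z = 0 := Set.indicator_of_notMem hne _
    have he := hcg f hfm M hf m hm z hz
    rw [hrpow, h.expParam_eq] at he
    have hid : (θk ^ m)⁻¹ * ∫ w, f w ∂(killKernel K hD₂ m z) - (m : ℝ) ^ l * Hk f z =
        (m : ℝ) ^ k * ((θk ^ m)⁻¹ * ((m : ℝ) ^ k)⁻¹ * ∫ w, f w ∂(killKernel K hD₂ m z)) := by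
      rw [hH]; field_simp; ring
    have hpow : (m : ℝ) ^ k ≤ (n : ℝ) ^ l * (1 / n) := by
      rw [mul_one_div, le_div_iff₀ hn0]
      calc (m : ℝ) ^ k * n ≤ (n : ℝ) ^ k * n := by gcongr
        _ = (n : ℝ) ^ (k + 1) := (pow_succ _ _).symm
        _ ≤ (n : ℝ) ^ l := pow_le_pow_right₀ hn1 hlt
    rw [hid, abs_mul, abs_of_nonneg (by positivity : (0 : ℝ) ≤ (m : ℝ) ^ k)]
    calc _ ≤ ((n : ℝ) ^ l * (1 / n)) * (cg * WR z * M) := by gcongr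
      _ = (0 + cg + 0) * (n : ℝ) ^ l * (0 + 1 / n) * M * WR z := by ring
      _ ≤ _ := by gcongr; exact zero_le_one

/-- A bound at a fixed time m, with a constant depending on m: it serves only for integrability and
finiteness. It follows from `exists_pointwise` with n = m + 1. -/
lemma exists_abs_right_le [IsMarkovKernel K]
    (h : ReducibleSetting K hD₁ hD₂ WP WR νP νR ηP ηR αP αR l) (m : ℕ) :
    ∃ c : ℝ, 0 ≤ c ∧ ∀ (f : E → ℝ), Measurable f → ∀ M : ℝ, (∀ x ∈ D₂, |f x| ≤ M * WR x) →
      ∀ z ∈ D₂, jRk z ≤ l → |∫ w, f w ∂(killKernel K hD₂ m z)| ≤ c * M * WR z := by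
  obtain ⟨C, hC0, hC⟩ := h.exists_pointwise
  obtain ⟨cl, hcl0, hcl⟩ := h.exists_abs_topLimit_le
  have hθ : 0 < θk := h.left.theta_pos
  have hα := h.αR_nonneg m
  set c₀ := C * ((m + 1 : ℕ) : ℝ) ^ l * (αR m + 1 / ((m + 1 : ℕ) : ℝ)) with hc₀
  refine ⟨θk ^ m * (c₀ + (m : ℝ) ^ l * cl), by positivity, fun f hfm M hf z hz hjz => ?_⟩
  have h1 := hC f hfm M hf (m + 1) m (Nat.lt_succ_self m) z hz hjz
  have h2 : |(m : ℝ) ^ l * Hk f z| ≤ (m : ℝ) ^ l * (cl * M * WR z) := by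
    rw [abs_mul, abs_of_nonneg (by positivity : (0 : ℝ) ≤ (m : ℝ) ^ l)]
    have := hcl f M hf z
    gcongr
  have h3 : |(θk ^ m)⁻¹ * ∫ w, f w ∂(killKernel K hD₂ m z)| ≤
      c₀ * M * WR z + (m : ℝ) ^ l * (cl * M * WR z) := by
    have := abs_sub_abs_le_abs_sub ((θk ^ m)⁻¹ * ∫ w, f w ∂(killKernel K hD₂ m z))
      ((m : ℝ) ^ l * Hk f z)
    linarith
  rw [abs_mul, abs_of_nonneg (by positivity : (0 : ℝ) ≤ (θk ^ m)⁻¹),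
    inv_mul_le_iff₀ (by positivity)] at h3
  calc _ ≤ _ := h3
    _ = _ := by ring

lemma measurable_integral_right {f : E → ℝ} (hfm : Measurable f) (m : ℕ) :
    Measurable fun z => ∫ w, f w ∂(killKernel K hD₂ m z) :=
  (hfm.stronglyMeasurable.integral_kernel (κ := killKernel K hD₂ m)).measurable

lemma measurable_integral_jump {g : E → ℝ} (hg : Measurable g) :
    Measurable fun y => ∫ z, g z ∂(K.restrict hD₂ y) :=
  (hg.stronglyMeasurable.integral_kernel (κ := K.restrict hD₂)).measurable

lemma integrable_integral_right [IsMarkovKernel K]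
    (h : ReducibleSetting K hD₁ hD₂ WP WR νP νR ηP ηR αP αR l)
    {f : E → ℝ} (hfm : Measurable f) {M : ℝ} (hf : ∀ x ∈ D₂, |f x| ≤ M * WR x) (m : ℕ) {y : E}
    (hy : y ∈ D₁) :
    Integrable (fun z => ∫ w, f w ∂(killKernel K hD₂ m z)) (K.restrict hD₂ y) := by
  obtain ⟨c, -, hc⟩ := h.exists_abs_right_le m
  refine ((h.integrable_jump hy).const_mul (c * M)).mono'
    (measurable_integral_right hfm m).aestronglyMeasurable ?_
  filter_upwards [ae_jump (K := K) (hD₂ := hD₂) y, h.entrance y hy] with z hz hjz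
  exact hc f hfm M hf z hz hjz

lemma integrable_topLimit [IsMarkovKernel K]
    (h : ReducibleSetting K hD₁ hD₂ WP WR νP νR ηP ηR αP αR l)
    {f : E → ℝ} {M : ℝ} (hf : ∀ x ∈ D₂, |f x| ≤ M * WR x) {y : E} (hy : y ∈ D₁) :
    Integrable (Hk f) (K.restrict hD₂ y) := by
  obtain ⟨c, -, hc⟩ := h.exists_abs_topLimit_le
  exact ((h.integrable_jump hy).const_mul (c * M)).mono'
    (h.measurable_topLimit hf).aestronglyMeasurable (ae_of_all _ fun z => hc f M hf z)

lemma exists_abs_jump_topLimit_le [IsMarkovKernel K]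
    (h : ReducibleSetting K hD₁ hD₂ WP WR νP νR ηP ηR αP αR l) :
    ∃ c : ℝ, 0 ≤ c ∧ ∀ (f : E → ℝ) (M : ℝ), (∀ x ∈ D₂, |f x| ≤ M * WR x) → ∀ y ∈ D₁,
      |∫ z, Hk f z ∂(K.restrict hD₂ y)| ≤ c * M * WP y := by
  obtain ⟨c, hc0, hc⟩ := h.exists_abs_topLimit_le
  refine ⟨c, hc0, fun f M hf y hy => ?_⟩
  have hM := h.right.bound_nonneg hf
  have := abs_integral_le_of_abs_le (ae_of_all _ (fun x => Set.mem_univ x))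
    (h.integrable_jump hy) (f := Hk f) (M := c * M) (fun z _ => hc f M hf z)
  exact this.trans (mul_le_mul_of_nonneg_left (h.integral_jump_le hy) (by positivity))

/-- The pointwise expansion is integrated over the jump, where j_R ≤ l almost surely; the moment
hypothesis on the jump replaces the weight W_R by W_P. -/
lemma exists_jump_expansion [IsMarkovKernel K]
    (h : ReducibleSetting K hD₁ hD₂ WP WR νP νR ηP ηR αP αR l) :
    ∃ C : ℝ, 0 ≤ C ∧ ∀ (f : E → ℝ), Measurable f → ∀ M : ℝ, (∀ x ∈ D₂, |f x| ≤ M * WR x) →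
      ∀ n m : ℕ, m < n → ∀ y ∈ D₁,
        |(θk ^ m)⁻¹ * ∫ z, ∫ w, f w ∂(killKernel K hD₂ m z) ∂(K.restrict hD₂ y)
            - (m : ℝ) ^ l * ∫ z, Hk f z ∂(K.restrict hD₂ y)| ≤
          C * (n : ℝ) ^ l * (αR m + 1 / n) * M * WP y := by
  obtain ⟨C, hC0, hC⟩ := h.exists_pointwise
  refine ⟨C, hC0, fun f hfm M hf n m hmn y hy => ?_⟩
  have hM := h.right.bound_nonneg hf
  have hα := h.αR_nonneg m
  rw [← integral_const_mul, ← integral_const_mul]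
  refine (abs_integral_sub_integral_le (b := C * (n : ℝ) ^ l * (αR m + 1 / n) * M)
    (h.integrable_jump hy)
    ((h.integrable_integral_right hfm hf m hy).const_mul _)
    ((h.integrable_topLimit hf hy).const_mul _) ?_).trans
    (mul_le_mul_of_nonneg_left (h.integral_jump_le hy) (by positivity))
  filter_upwards [ae_jump (K := K) (hD₂ := hD₂) y, h.entrance y hy] with z hz hjz
  exact hC f hfm M hf n m hmn z hz hjz

lemma exists_abs_jump_right_le [IsMarkovKernel K]
    (h : ReducibleSetting K hD₁ hD₂ WP WR νP νR ηP ηR αP αR l)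
    (m : ℕ) : ∃ c : ℝ, 0 ≤ c ∧ ∀ (f : E → ℝ), Measurable f → ∀ M : ℝ,
      (∀ x ∈ D₂, |f x| ≤ M * WR x) → ∀ y ∈ D₁,
        |∫ z, ∫ w, f w ∂(killKernel K hD₂ m z) ∂(K.restrict hD₂ y)| ≤ c * M * WP y := by
  obtain ⟨c, hc0, hc⟩ := h.exists_abs_right_le m
  refine ⟨c, hc0, fun f hfm M hf y hy => ?_⟩
  have hM := h.right.bound_nonneg hf
  have hae : ∀ᵐ z ∂(K.restrict hD₂ y), |∫ w, f w ∂(killKernel K hD₂ m z)| ≤ c * M * WR z := by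
    filter_upwards [ae_jump (K := K) (hD₂ := hD₂) y, h.entrance y hy] with z hz hjz
    exact hc f hfm M hf z hz hjz
  have := norm_integral_le_of_norm_le
    (f := fun z => ∫ w, f w ∂(killKernel K hD₂ m z)) ((h.integrable_jump hy).const_mul (c * M)) hae
  rw [integral_const_mul] at this
  exact this.trans (mul_le_mul_of_nonneg_left (h.integral_jump_le hy) (by positivity))

/-- Since j_P = 0, the growth bound carries no power of k; it is therefore uniform in k and can be
summed over crossing times. -/
lemma exists_left_W_le (h : ReducibleSetting K hD₁ hD₂ WP WR νP νR ηP ηR αP αR l) :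
    ∃ c : ℝ, 0 ≤ c ∧ ∀ (k : ℕ), ∀ x ∈ D₁,
      (θk ^ k)⁻¹ * ∫ y, WP y ∂(killKernel K hD₁ k x) ≤ c * WP x := by
  obtain ⟨c, hc0, hc⟩ := h.left.exists_growth
  refine ⟨1 + c, by positivity, fun k x hx => ?_⟩
  have hW := h.left.W_nonneg x
  rcases Nat.eq_zero_or_pos k with rfl | hk
  · rw [killKernel_zero_apply hD₁ hx, integral_dirac' _ _ h.left.W_meas.stronglyMeasurable]
    simp only [pow_zero, inv_one, one_mul]
    nlinarith
  · have := (le_abs_self _).trans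
      (hc WP h.left.W_meas 1 (fun x _ => h.left.abs_W_le x) k hk x hx)
    rw [h.poly_left x hx, neg_zero, Real.rpow_zero, mul_one, mul_one] at this
    nlinarith

/-- Convergence of the renormalized semigroup on `D₁`, at all times `k ≥ 0`. -/
lemma exists_left_estimate (h : ReducibleSetting K hD₁ hD₂ WP WR νP νR ηP ηR αP αR l) :
    ∃ c : ℝ, 0 ≤ c ∧ ∀ (g : E → ℝ), Measurable g → ∀ M : ℝ, (∀ x ∈ D₁, |g x| ≤ M * WP x) →
      ∀ (k : ℕ), ∀ x ∈ D₁, |(θk ^ k)⁻¹ * ∫ y, g y ∂(killKernel K hD₁ k x) - limitFun νP ηP g x| ≤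
        c * αP k * (WP x * M) := by
  obtain ⟨c, hc0, hc⟩ := h.left.exists_abs_limitFun_le
  refine ⟨1 + c, by positivity, fun g hgm M hg k x hx => ?_⟩
  have hM := h.left.bound_nonneg hg
  have hW := h.left.W_nonneg x
  have hα := h.αP_nonneg k
  rcases Nat.eq_zero_or_pos k with rfl | hk
  · rw [killKernel_zero_apply hD₁ hx, integral_dirac' _ _ hgm.stronglyMeasurable, h.alpha_left]
    simp only [pow_zero, inv_one, one_mul]
    calc _ ≤ |g x| + |limitFun νP ηP g x| := abs_sub _ _
      _ ≤ M * WP x + c * WP x * M :=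
        add_le_add (hg x hx) ((h.left.abs_limitFun_le_tsum hg x).trans (hc g M hg x))
      _ = _ := by ring
  · have := h.left.estimate_of_le hgm hg hk hx
    rw [h.poly_left x hx, neg_zero, Real.rpow_zero, mul_one] at this
    calc _ ≤ αP k * WP x * M := this
      _ = (1 + 0) * αP k * (WP x * M) := by ring
      _ ≤ _ := by gcongr

/-! ### The weight on D₁ ∪ D₂ and integrability -/

lemma WP_eq_zero (h : ReducibleSetting K hD₁ hD₂ WP WR νP νR ηP ηR αP αR l) {x : E}
    (hx : x ∈ D₂) : WP x = 0 :=
  h.left.W_zero x fun hx' => h.disjoint.le_bot ⟨hx', hx⟩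

lemma WR_eq_zero (h : ReducibleSetting K hD₁ hD₂ WP WR νP νR ηP ηR αP αR l) {x : E}
    (hx : x ∈ D₁) : WR x = 0 :=
  h.right.W_zero x fun hx' => h.disjoint.le_bot ⟨hx, hx'⟩

lemma abs_le_left (h : ReducibleSetting K hD₁ hD₂ WP WR νP νR ηP ηR αP αR l) {f : E → ℝ} {M : ℝ}
    (hf : ∀ x ∈ D₁ ∪ D₂, |f x| ≤ M * (WP + WR) x) : ∀ x ∈ D₁, |f x| ≤ M * WP x := fun x hx => by
  simpa [h.WR_eq_zero hx] using hf x (Or.inl hx)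

lemma abs_le_right (h : ReducibleSetting K hD₁ hD₂ WP WR νP νR ηP ηR αP αR l) {f : E → ℝ} {M : ℝ}
    (hf : ∀ x ∈ D₁ ∪ D₂, |f x| ≤ M * (WP + WR) x) : ∀ x ∈ D₂, |f x| ≤ M * WR x := fun x hx => by
  simpa [h.WP_eq_zero hx] using hf x (Or.inr hx)

lemma W_nonneg (h : ReducibleSetting K hD₁ hD₂ WP WR νP νR ηP ηR αP αR l) (x : E) :
    0 ≤ (WP + WR) x :=
  add_nonneg (h.left.W_nonneg x) (h.right.W_nonneg x)

lemma one_le_W (h : ReducibleSetting K hD₁ hD₂ WP WR νP νR ηP ηR αP αR l) :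
    ∀ x ∈ D₁ ∪ D₂, 1 ≤ (WP + WR) x := by
  rintro x (hx | hx)
  · simpa [h.WR_eq_zero hx] using h.left.W_one_le x hx
  · simpa [h.WP_eq_zero hx] using h.right.W_one_le x hx

lemma measurable_W (h : ReducibleSetting K hD₁ hD₂ WP WR νP νR ηP ηR αP αR l) :
    Measurable (WP + WR) :=
  h.left.W_meas.add h.right.W_meas

lemma lintegral_right_congr (h : ReducibleSetting K hD₁ hD₂ WP WR νP νR ηP ηR αP αR l) (m : ℕ)
    (z : E) : ∫⁻ w, ENNReal.ofReal ((WP + WR) w) ∂(killKernel K hD₂ m z) =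
      ∫⁻ w, ENNReal.ofReal (WR w) ∂(killKernel K hD₂ m z) := by
  refine lintegral_congr_ae ?_
  filter_upwards [ae_killKernel (K := K) hD₂ m z] with w hw
  simp [h.WP_eq_zero hw]

lemma lintegral_left_congr (h : ReducibleSetting K hD₁ hD₂ WP WR νP νR ηP ηR αP αR l) (k : ℕ)
    (x : E) : ∫⁻ y, ENNReal.ofReal ((WP + WR) y) ∂(killKernel K hD₁ k x) =
      ∫⁻ y, ENNReal.ofReal (WP y) ∂(killKernel K hD₁ k x) := by
  refine lintegral_congr_ae ?_
  filter_upwards [ae_killKernel (K := K) hD₁ k x] with w hw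
  simp [h.WR_eq_zero hw]

/-- In the decomposition over crossing times, the stay in D₂ and the jump send W_R to at most a
multiple of W_P, which P_k integrates. -/
lemma lintegral_union_lt_top [IsMarkovKernel K]
    (h : ReducibleSetting K hD₁ hD₂ WP WR νP νR ηP ηR αP αR l) (n : ℕ) {x : E}
    (hx : x ∈ D₁ ∪ D₂) :
    ∫⁻ y, ENNReal.ofReal ((WP + WR) y) ∂(killKernel K (hD₁.union hD₂) n x) < ∞ := by
  rcases hx with hx | hx
  swap
  · rw [killKernel_union_of_mem_right hD₁ hD₂ h.disjoint h.closed hx, h.lintegral_right_congr]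
    exact h.right.W_integrable n x hx
  rw [lintegral_killKernel_union hD₁ hD₂ h.disjoint h.closed hx n h.measurable_W.ennreal_ofReal,
    h.lintegral_left_congr]
  refine ENNReal.add_lt_top.2 ⟨h.left.W_integrable n x hx, ENNReal.sum_lt_top.2 fun k _ => ?_⟩
  obtain ⟨c, hc0, hc⟩ := h.exists_abs_right_le (n - 1 - k)
  have hz : ∀ y ∈ D₁, ∫⁻ z, ∫⁻ w, ENNReal.ofReal ((WP + WR) w) ∂(killKernel K hD₂ (n - 1 - k) z)
      ∂(K.restrict hD₂ y) ≤ ENNReal.ofReal c * ENNReal.ofReal (WP y) := by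
    intro y hy
    refine le_trans ?_ (mul_le_mul_right (h.lintegral_jump_le hy) _)
    rw [← lintegral_const_mul _ h.right.W_meas.ennreal_ofReal]
    refine lintegral_mono_ae ?_
    filter_upwards [ae_jump (K := K) (hD₂ := hD₂) y, h.entrance y hy] with z hz hjz
    rw [h.lintegral_right_congr, ← ofReal_integral_eq_lintegral_ofReal
      (h.right.integrable_W_κ (n - 1 - k) hz) (ae_of_all _ h.right.W_nonneg),
      ← ENNReal.ofReal_mul hc0]
    refine ENNReal.ofReal_le_ofReal ((le_abs_self _).trans ?_)
    have := hc WR h.right.W_meas 1 (fun x _ => h.right.abs_W_le x) z hz hjz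
    rwa [mul_one] at this
  calc _ ≤ ∫⁻ y, ENNReal.ofReal c * ENNReal.ofReal (WP y) ∂(killKernel K hD₁ k x) := by
        refine lintegral_mono_ae ?_
        filter_upwards [ae_killKernel (K := K) hD₁ k x] with y hy
        exact hz y hy
    _ = ENNReal.ofReal c * ∫⁻ y, ENNReal.ofReal (WP y) ∂(killKernel K hD₁ k x) :=
        lintegral_const_mul _ h.left.W_meas.ennreal_ofReal
    _ < ∞ := ENNReal.mul_lt_top ENNReal.ofReal_lt_top (h.left.W_integrable k x hx)

lemma integrable_union [IsMarkovKernel K]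
    (h : ReducibleSetting K hD₁ hD₂ WP WR νP νR ηP ηR αP αR l) {f : E → ℝ} (hfm : Measurable f)
    {M : ℝ} (hf : ∀ x ∈ D₁ ∪ D₂, |f x| ≤ M * (WP + WR) x) (n : ℕ) {x : E} (hx : x ∈ D₁ ∪ D₂) :
    Integrable f (killKernel K (hD₁.union hD₂) n x) := by
  refine integrable_of_abs_le (ae_killKernel (hD₁.union hD₂) n x) (W := WP + WR) ?_ hfm hf
  refine ⟨h.measurable_W.aestronglyMeasurable, ?_⟩
  rw [hasFiniteIntegral_iff_ofReal (ae_of_all _ h.W_nonneg)]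
  exact h.lintegral_union_lt_top n hx

/-- Integrability against the whole measure passes to each summand of the decomposition, which
licenses the iterated Bochner integrals. -/
lemma integral_union [IsMarkovKernel K]
    (h : ReducibleSetting K hD₁ hD₂ WP WR νP νR ηP ηR αP αR l) {f : E → ℝ} (hfm : Measurable f)
    {M : ℝ} (hf : ∀ x ∈ D₁ ∪ D₂, |f x| ≤ M * (WP + WR) x) (n : ℕ) {x : E} (hx : x ∈ D₁) :
    ∫ y, f y ∂(killKernel K (hD₁.union hD₂) n x) = ∫ y, f y ∂(killKernel K hD₁ n x) +
      ∑ k ∈ Finset.range n, ∫ y, ∫ z, ∫ w, f w ∂(killKernel K hD₂ (n - 1 - k) z)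
        ∂(K.restrict hD₂ y) ∂(killKernel K hD₁ k x) := by
  have hint := h.integrable_union hfm hf n (Or.inl hx)
  rw [killKernel_union_of_mem_left hD₁ hD₂ h.disjoint h.closed hx n] at hint ⊢
  obtain ⟨h1, h2⟩ := integrable_add_measure.1 hint
  have h3 := integrable_finsetSum_measure.1 h2
  rw [integral_add_measure h1 h2, integral_finsetSum_measure h3]
  congr 1
  refine Finset.sum_congr rfl fun k hk => ?_
  rw [Kernel.integral_comp (h3 k hk), Kernel.integral_comp (h3 k hk).integral_comp]

/-! ### The expansion on D₁ -/

/-- The expansion on `D₁`, with the limit expressed through the semigroup on `D₁` only. -/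
lemma exists_left_expansion [IsMarkovKernel K]
    (h : ReducibleSetting K hD₁ hD₂ WP WR νP νR ηP ηR αP αR l) :
    ∃ C : ℝ, 0 ≤ C ∧ ∀ (f : E → ℝ), Measurable f → ∀ M : ℝ,
      (∀ x ∈ D₁ ∪ D₂, |f x| ≤ M * (WP + WR) x) → ∀ n : ℕ, 1 ≤ n → ∀ x ∈ D₁,
        |(θk ^ n)⁻¹ * ((n : ℝ) ^ (l + 1))⁻¹ * ∫ y, f y ∂(killKernel K (hD₁.union hD₂) n x)
          - θk⁻¹ / (1 + l) * limitFun νP ηP (fun y => ∫ z, Hk f z ∂(K.restrict hD₂ y)) x| ≤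
        C / n * (∑ k ∈ Finset.range (n + 1), (αP k + αR k)) * (WP x * M) := by
  obtain ⟨c₁, hc₁0, hc₁⟩ := h.exists_jump_expansion
  obtain ⟨c₂, hc₂0, hc₂⟩ := h.exists_left_W_le
  obtain ⟨c₃, hc₃0, hc₃⟩ := h.exists_left_estimate
  obtain ⟨c₄, hc₄0, hc₄⟩ := h.exists_abs_jump_topLimit_le
  obtain ⟨c₅, hc₅0, hc₅⟩ := h.left.exists_abs_limitFun_le
  have hθ : 0 < θk := h.left.theta_pos
  set θ := θk with hθdef
  refine ⟨c₂ + θ⁻¹ * (2 * (c₁ * c₂) + c₃ * c₄ + c₅ * c₄), by positivity,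
    fun f hfm M hf n hn x hx => ?_⟩
  have hfP := h.abs_le_left hf
  have hfR := h.abs_le_right hf
  have hM := h.left.bound_nonneg hfP
  have hWx := h.left.W_nonneg x
  set G := fun y => ∫ z, Hk f z ∂(K.restrict hD₂ y) with hG
  have hGm : Measurable G := measurable_integral_jump (h.measurable_topLimit hfR)
  have hGb : ∀ y ∈ D₁, |G y| ≤ c₄ * M * WP y := hc₄ f M hfR
  set Φ := fun (m : ℕ) y => ∫ z, ∫ w, f w ∂(killKernel K hD₂ m z) ∂(K.restrict hD₂ y) with hΦ
  have hΦm : ∀ m, Measurable (Φ m) := fun m =>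
    measurable_integral_jump (measurable_integral_right hfm m)
  have hGi : ∀ k, Integrable G (killKernel K hD₁ k x) := fun k =>
    integrable_of_abs_le (ae_killKernel hD₁ k x) (h.left.integrable_W_κ k hx) hGm hGb
  have hΦi : ∀ m k, Integrable (Φ m) (killKernel K hD₁ k x) := fun m k => by
    obtain ⟨c, -, hc⟩ := h.exists_abs_jump_right_le m
    exact integrable_of_abs_le (ae_killKernel hD₁ k x) (h.left.integrable_W_κ k hx) (hΦm m)
      (hc f hfm M hfR)
  have hn0 : (0 : ℝ) < n := by exact_mod_cast hn
  have hid : (θ ^ n)⁻¹ * ((n : ℝ) ^ (l + 1))⁻¹ * ∫ y, f y ∂(killKernel K (hD₁.union hD₂) n x) =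
      ((n : ℝ) ^ (l + 1))⁻¹ * ((θ ^ n)⁻¹ * ∫ y, f y ∂(killKernel K hD₁ n x) +
        θ⁻¹ * ∑ k ∈ Finset.range n,
          (θ ^ (n - 1))⁻¹ * ∫ y, Φ (n - 1 - k) y ∂(killKernel K hD₁ k x)) := by
    -- The crossing itself uses one step, n = k + 1 + m, whence the isolated factor θ⁻¹.
    have hpow : (θ ^ n)⁻¹ = θ⁻¹ * (θ ^ (n - 1))⁻¹ := by
      rw [← mul_inv, ← pow_succ', Nat.sub_add_cancel hn]
    rw [h.integral_union hfm hf n hx, ← Finset.mul_sum, hpow]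
    ring
  rw [hid]
  refine abs_average_sub_le (u := fun k => (θ ^ k)⁻¹ * ∫ y, G y ∂(killKernel K hD₁ k x)) hθ hn
    (by positivity) (by positivity) (by positivity) (by positivity) hc₂0 h.αP_nonneg h.αR_nonneg
    h.alpha_left ?_ ?_ ?_ ?_
  · intro k hk
    set m := n - 1 - k with hm
    have hα := h.αR_nonneg m
    have hpow : θ ^ (n - 1) = θ ^ k * θ ^ m := by rw [← pow_add]; congr 1; omega
    have hid2 : (θ ^ (n - 1))⁻¹ * ∫ y, Φ m y ∂(killKernel K hD₁ k x) -
        (m : ℝ) ^ l * ((θ ^ k)⁻¹ * ∫ y, G y ∂(killKernel K hD₁ k x)) =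
        (θ ^ k)⁻¹ * (∫ y, (θ ^ m)⁻¹ * Φ m y ∂(killKernel K hD₁ k x) -
          ∫ y, (m : ℝ) ^ l * G y ∂(killKernel K hD₁ k x)) := by
      rw [integral_const_mul, integral_const_mul, hpow, mul_inv]
      ring
    rw [hid2, abs_mul, abs_of_nonneg (by positivity : 0 ≤ (θ ^ k)⁻¹)]
    have hle := abs_integral_sub_integral_le (b := c₁ * (n : ℝ) ^ l * (αR m + 1 / n) * M)
      (h.left.integrable_W_κ k hx) ((hΦi m k).const_mul (θ ^ m)⁻¹)
      ((hGi k).const_mul ((m : ℝ) ^ l)) (by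
        filter_upwards [ae_killKernel (K := K) hD₁ k x] with y hy
        exact hc₁ f hfm M hfR n m (by omega) y hy)
    calc _ ≤ (θ ^ k)⁻¹ * (c₁ * (n : ℝ) ^ l * (αR m + 1 / n) * M *
          ∫ y, WP y ∂(killKernel K hD₁ k x)) := by gcongr
      _ = (c₁ * (n : ℝ) ^ l * (αR m + 1 / n) * M) *
          ((θ ^ k)⁻¹ * ∫ y, WP y ∂(killKernel K hD₁ k x)) := by ring
      _ ≤ (c₁ * (n : ℝ) ^ l * (αR m + 1 / n) * M) * (c₂ * WP x) := by
          have := hc₂ k x hx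
          gcongr
      _ = _ := by ring
  · intro k
    calc _ ≤ c₃ * αP k * (WP x * (c₄ * M)) := hc₃ G hGm (c₄ * M) hGb k x hx
      _ = _ := by ring
  · calc _ ≤ c₅ * WP x * (c₄ * M) :=
          (h.left.abs_limitFun_le_tsum hGb x).trans (hc₅ G (c₄ * M) hGb x)
      _ = _ := by ring
  · rw [abs_mul, abs_of_nonneg (by positivity : 0 ≤ (θ ^ n)⁻¹)]
    calc _ ≤ (θ ^ n)⁻¹ * (M * ∫ y, WP y ∂(killKernel K hD₁ n x)) := by
          have := abs_integral_le_of_abs_le (ae_killKernel (K := K) hD₁ n x)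
            (h.left.integrable_W_κ n hx) hfP
          gcongr
      _ = M * ((θ ^ n)⁻¹ * ∫ y, WP y ∂(killKernel K hD₁ n x)) := by ring
      _ ≤ M * (c₂ * WP x) := mul_le_mul_of_nonneg_left (hc₂ n x hx) hM
      _ = _ := by ring

/-! ### Series of entrance coefficients and identification of the limit -/

lemma lintegral_bind_jump_le (h : ReducibleSetting K hD₁ hD₂ WP WR νP νR ηP ηR αP αR l)
    (k : IP) : ∫⁻ z, ENNReal.ofReal (WR z) ∂(jumpLaw K hD₂ (νP k)) ≤ ∫⁻ y, ENNReal.ofReal (WP y) ∂(νP k) := by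
  rw [jumpLaw, Measure.lintegral_bind (K.restrict hD₂).aemeasurable h.right.W_meas.ennreal_ofReal.aemeasurable]
  refine lintegral_mono_ae ?_
  filter_upwards [h.left.ae_ν k] with y hy
  exact h.lintegral_jump_le hy

lemma integrable_bind_jump (h : ReducibleSetting K hD₁ hD₂ WP WR νP νR ηP ηR αP αR l)
    (k : IP) : Integrable WR (jumpLaw K hD₂ (νP k)) := by
  refine ⟨h.right.W_meas.aestronglyMeasurable, ?_⟩
  rw [hasFiniteIntegral_iff_ofReal (ae_of_all _ h.right.W_nonneg)]
  exact (h.lintegral_bind_jump_le k).trans_lt (h.left.ν_W k)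

lemma integral_bind_jump_le (h : ReducibleSetting K hD₁ hD₂ WP WR νP νR ηP ηR αP αR l)
    (k : IP) : ∫ z, WR z ∂(jumpLaw K hD₂ (νP k)) ≤ ∫ y, WP y ∂(νP k) := by
  rw [integral_eq_lintegral_of_nonneg_ae (ae_of_all _ h.right.W_nonneg)
    h.right.W_meas.aestronglyMeasurable]
  refine ENNReal.toReal_le_of_le_ofReal (h.left.ν_W_nonneg k) ?_
  rw [ofReal_integral_eq_lintegral_ofReal (h.left.integrable_W_ν k)
    (ae_of_all _ h.left.W_nonneg)]
  exact h.lintegral_bind_jump_le k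

lemma integral_bind_jump [IsMarkovKernel K] {ν : Measure E} [IsProbabilityMeasure ν] {g : E → ℝ}
    (hg : Integrable g (jumpLaw K hD₂ ν)) :
    ∫ z, g z ∂(jumpLaw K hD₂ ν) = ∫ y, ∫ z, g z ∂(K.restrict hD₂ y) ∂ν := by
  rw [jumpLaw, Measure.comp_eq_comp_const_apply] at hg ⊢
  rw [Kernel.integral_comp hg, Kernel.const_apply]

lemma coef_nonneg (h : ReducibleSetting K hD₁ hD₂ WP WR νP νR ηP ηR αP αR l) (k : IP) (i : IR) :
    0 ≤ entranceCoef K hD₂ l (νP k) (ηR i) :=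
  integral_nonneg fun z => Set.indicator_nonneg (fun y _ => h.right.η_nonneg i y) z

lemma indicator_η_le (h : ReducibleSetting K hD₁ hD₂ WP WR νP νR ηP ηR αP αR l) (i : IR) :
    ∃ c : ℝ, ∀ z, |Set.indicator {y | jRk y = l} (ηR i) z| ≤ c * WR z := by
  obtain ⟨c, hc⟩ := h.right.η_bdd i
  refine ⟨c, fun z => ?_⟩
  rw [abs_of_nonneg (Set.indicator_nonneg (fun y _ => h.right.η_nonneg i y) z)]
  by_cases hz : z ∈ D₂
  · exact (Set.indicator_le_self' (fun _ _ => h.right.η_nonneg i _) z).trans (hc z hz)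
  · have h0 := h.right.η_zero i z hz
    refine (Set.indicator_le_self' (fun _ _ => h.right.η_nonneg i _) z).trans ?_
    rw [h0, h.right.W_zero z hz, mul_zero]

lemma measurable_indicator_η [IsMarkovKernel K]
    (h : ReducibleSetting K hD₁ hD₂ WP WR νP νR ηP ηR αP αR l) (i : IR) :
    Measurable (Set.indicator {y | jRk y = l} (ηR i)) :=
  (h.right.η_meas i).indicator (h.measurable_jR (measurableSet_singleton (l : ℝ)))

lemma integrable_indicator_η [IsMarkovKernel K]
    (h : ReducibleSetting K hD₁ hD₂ WP WR νP νR ηP ηR αP αR l) (i : IR) {μ : Measure E}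
    (hμ : Integrable WR μ) : Integrable (Set.indicator {y | jRk y = l} (ηR i)) μ := by
  obtain ⟨c, hc⟩ := h.indicator_η_le i
  exact (hμ.const_mul c).mono' (h.measurable_indicator_η i).aestronglyMeasurable (ae_of_all _ hc)

/-- Finite partial sums go inside the integral over the entrance law, where Assumption (A) on D₂
bounds them by c W_R, and the jump bounds the integral of W_R by that of W_P. -/
lemma exists_coef_sum_le [IsMarkovKernel K]
    (h : ReducibleSetting K hD₁ hD₂ WP WR νP νR ηP ηR αP αR l) : ∃ c : ℝ, 0 ≤ c ∧ ∀ k : IP,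
      (Summable fun i => entranceCoef K hD₂ l (νP k) (ηR i) * ∫ w, WR w ∂(νR i)) ∧
        ∑' i, entranceCoef K hD₂ l (νP k) (ηR i) * ∫ w, WR w ∂(νR i) ≤ c * ∫ y, WP y ∂(νP k) := by
  obtain ⟨c, hc0, hc⟩ := h.right.exists_sum_W_le
  refine ⟨c, hc0, fun k => ?_⟩
  have h0 : ∀ i, 0 ≤ entranceCoef K hD₂ l (νP k) (ηR i) * ∫ w, WR w ∂(νR i) := fun i =>
    mul_nonneg (h.coef_nonneg k i) (h.right.ν_W_nonneg i)
  have hle : ∀ s : Finset IR, ∑ i ∈ s, entranceCoef K hD₂ l (νP k) (ηR i) * ∫ w, WR w ∂(νR i) ≤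
      c * ∫ y, WP y ∂(νP k) := by
    intro s
    have hint : ∀ i ∈ s, Integrable (fun z => Set.indicator {y | jRk y = l} (ηR i) z *
        ∫ w, WR w ∂(νR i)) (jumpLaw K hD₂ (νP k)) := fun i _ =>
      (h.integrable_indicator_η i (h.integrable_bind_jump k)).mul_const _
    calc _ = ∫ z, ∑ i ∈ s, Set.indicator {y | jRk y = l} (ηR i) z * ∫ w, WR w ∂(νR i)
          ∂(jumpLaw K hD₂ (νP k)) := by
          rw [integral_finsetSum _ hint]
          refine Finset.sum_congr rfl fun i _ => ?_
          rw [integral_mul_const, entranceCoef]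
      _ ≤ ∫ z, c * WR z ∂(jumpLaw K hD₂ (νP k)) := by
          refine integral_mono (integrable_finsetSum _ hint)
            ((h.integrable_bind_jump k).const_mul c) fun z => ?_
          refine le_trans ?_ (hc z).2
          refine le_trans (Finset.sum_le_sum fun i _ => ?_) ((hc z).1.sum_le_tsum s fun i _ =>
            mul_nonneg (h.right.η_nonneg i z) (h.right.ν_W_nonneg i))
          exact mul_le_mul_of_nonneg_right
            (Set.indicator_le_self' (fun _ _ => h.right.η_nonneg i _) z) (h.right.ν_W_nonneg i)
      _ = c * ∫ z, WR z ∂(jumpLaw K hD₂ (νP k)) := integral_const_mul _ _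
      _ ≤ _ := mul_le_mul_of_nonneg_left (h.integral_bind_jump_le k) hc0
  have hs := summable_of_sum_le h0 hle
  exact ⟨hs, hs.tsum_le_of_sum_le hle⟩

/-- Joint summability over pairs, with the nonnegative weight W_R in place of f. It dominates the
general case and justifies exchanging the two sums. -/
lemma summable_coef_prod [IsMarkovKernel K]
    (h : ReducibleSetting K hD₁ hD₂ WP WR νP νR ηP ηR αP αR l) (x : E) :
    Summable fun p : IP × IR => ηP p.1 x * (entranceCoef K hD₂ l (νP p.1) (ηR p.2) * ∫ w, WR w ∂(νR p.2)) := by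
  obtain ⟨c, hc0, hc⟩ := h.exists_coef_sum_le
  obtain ⟨c', -, hc'⟩ := h.left.exists_sum_W_le
  have h0 : ∀ k i, 0 ≤ entranceCoef K hD₂ l (νP k) (ηR i) * ∫ w, WR w ∂(νR i) := fun k i =>
    mul_nonneg (h.coef_nonneg k i) (h.right.ν_W_nonneg i)
  have hF : 0 ≤ fun p : IP × IR => ηP p.1 x *
      (entranceCoef K hD₂ l (νP p.1) (ηR p.2) * ∫ w, WR w ∂(νR p.2)) := fun p =>
    mul_nonneg (h.left.η_nonneg p.1 x) (h0 p.1 p.2)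
  rw [summable_prod_of_nonneg hF]
  refine ⟨fun k => (hc k).1.mul_left (ηP k x), ?_⟩
  refine Summable.of_nonneg_of_le
    (fun k => tsum_nonneg fun i => mul_nonneg (h.left.η_nonneg k x) (h0 k i))
    (fun k => ?_) ((hc' x).1.mul_left c)
  dsimp only
  rw [tsum_mul_left]
  calc _ ≤ ηP k x * (c * ∫ y, WP y ∂(νP k)) :=
        mul_le_mul_of_nonneg_left (hc k).2 (h.left.η_nonneg k x)
    _ = _ := by ring

lemma summable_coef_prod_apply [IsMarkovKernel K]
    (h : ReducibleSetting K hD₁ hD₂ WP WR νP νR ηP ηR αP αR l) {f : E → ℝ} {M : ℝ}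
    (hf : ∀ x ∈ D₂, |f x| ≤ M * WR x) (x : E) :
    Summable fun p : IP × IR => ηP p.1 x * (entranceCoef K hD₂ l (νP p.1) (ηR p.2) * ∫ w, f w ∂(νR p.2)) := by
  refine Summable.of_norm_bounded ((h.summable_coef_prod x).mul_left M) fun p => ?_
  rw [Real.norm_eq_abs, abs_mul, abs_mul, abs_of_nonneg (h.left.η_nonneg p.1 x),
    abs_of_nonneg (h.coef_nonneg p.1 p.2)]
  calc _ ≤ ηP p.1 x * (entranceCoef K hD₂ l (νP p.1) (ηR p.2) * (M * ∫ w, WR w ∂(νR p.2))) :=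
        mul_le_mul_of_nonneg_left (mul_le_mul_of_nonneg_left (h.right.abs_ν_le hf p.2)
          (h.coef_nonneg p.1 p.2)) (h.left.η_nonneg p.1 x)
    _ = _ := by ring

lemma one_le_ν_W (h : ReducibleSetting K hD₁ hD₂ WP WR νP νR ηP ηR αP αR l) (i : IR) :
    1 ≤ ∫ w, WR w ∂(νR i) := by
  have := h.right.ν_prob i
  calc (1 : ℝ) = ∫ _, (1 : ℝ) ∂(νR i) := by simp
    _ ≤ _ := integral_mono_ae (integrable_const _) (h.right.integrable_W_ν i)
        ((h.right.ae_ν i).mono fun w hw => h.right.W_one_le w hw)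

/-- The factor ν_{R,i}(W_R) is at least 1, so it may be dropped from the jointly summable family. -/
lemma summable_coef [IsMarkovKernel K]
    (h : ReducibleSetting K hD₁ hD₂ WP WR νP νR ηP ηR αP αR l) (i : IR) (x : E) :
    Summable fun k => ηP k x * entranceCoef K hD₂ l (νP k) (ηR i) := by
  have hs := (h.summable_coef_prod x).prod_symm.prod_factor i
  refine Summable.of_nonneg_of_le
    (fun k => mul_nonneg (h.left.η_nonneg k x) (h.coef_nonneg k i)) (fun k => ?_) hs
  exact mul_le_mul_of_nonneg_left
    (le_mul_of_one_le_right (h.coef_nonneg k i) (h.one_le_ν_W i)) (h.left.η_nonneg k x)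

/-- The series defining H f is integrated term by term against the entrance law, its L¹ norms being
summable. -/
lemma integral_jump_topLimit [IsMarkovKernel K]
    (h : ReducibleSetting K hD₁ hD₂ WP WR νP νR ηP ηR αP αR l) {f : E → ℝ} {M : ℝ}
    (hf : ∀ x ∈ D₂, |f x| ≤ M * WR x) (k : IP) :
    ∫ y, ∫ z, Hk f z ∂(K.restrict hD₂ y) ∂(νP k) =
      ∑' i, entranceCoef K hD₂ l (νP k) (ηR i) * ∫ w, f w ∂(νR i) := by
  have := h.left.ν_prob k
  have := h.right.countable
  obtain ⟨c, -, hc⟩ := h.exists_abs_topLimit_le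
  have hHi : Integrable (Hk f) (jumpLaw K hD₂ (νP k)) :=
    ((h.integrable_bind_jump k).const_mul (c * M)).mono'
      (h.measurable_topLimit hf).aestronglyMeasurable (ae_of_all _ fun z => hc f M hf z)
  rw [← integral_bind_jump hHi]
  have hH : ∀ z, Hk f z =
      ∑' i, Set.indicator {y | jRk y = l} (ηR i) z * ∫ w, f w ∂(νR i) := by
    intro z
    by_cases hz : z ∈ {y | jRk y = l}
    · simp only [topLimit, Set.indicator_of_mem hz, limitFun]
    · simp only [topLimit, Set.indicator_of_notMem hz, zero_mul, tsum_zero]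
  have hint : ∀ i, Integrable (fun z => Set.indicator {y | jRk y = l} (ηR i) z *
      ∫ w, f w ∂(νR i)) (jumpLaw K hD₂ (νP k)) := fun i =>
    (h.integrable_indicator_η i (h.integrable_bind_jump k)).mul_const _
  have hnorm : ∀ i, ∫ z, ‖Set.indicator {y | jRk y = l} (ηR i) z * ∫ w, f w ∂(νR i)‖
      ∂(jumpLaw K hD₂ (νP k)) = entranceCoef K hD₂ l (νP k) (ηR i) * |∫ w, f w ∂(νR i)| := by
    intro i
    rw [entranceCoef, ← integral_mul_const]
    refine integral_congr_ae (ae_of_all _ fun z => ?_)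
    simp only [norm_mul, Real.norm_eq_abs]
    rw [abs_of_nonneg (Set.indicator_nonneg (fun y _ => h.right.η_nonneg i y) z)]
  obtain ⟨c', -, hc'⟩ := h.exists_coef_sum_le
  have hsum : Summable fun i => ∫ z, ‖Set.indicator {y | jRk y = l} (ηR i) z *
      ∫ w, f w ∂(νR i)‖ ∂(jumpLaw K hD₂ (νP k)) := by
    refine Summable.of_nonneg_of_le (fun i => integral_nonneg fun _ => norm_nonneg _)
      (fun i => ?_) ((hc' k).1.mul_left M)
    rw [hnorm i]
    calc _ ≤ entranceCoef K hD₂ l (νP k) (ηR i) * (M * ∫ w, WR w ∂(νR i)) :=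
          mul_le_mul_of_nonneg_left (h.right.abs_ν_le hf i) (h.coef_nonneg k i)
      _ = _ := by ring
  simp_rw [hH]
  rw [← (hasSum_integral_of_summable_integral_norm hint hsum).tsum_eq]
  refine tsum_congr fun i => ?_
  rw [integral_mul_const, entranceCoef]

lemma summable_coef_apply [IsMarkovKernel K]
    (h : ReducibleSetting K hD₁ hD₂ WP WR νP νR ηP ηR αP αR l) {f : E → ℝ} {M : ℝ}
    (hf : ∀ x ∈ D₂, |f x| ≤ M * WR x) (x : E) :
    Summable fun i => (∑' k, ηP k x * entranceCoef K hD₂ l (νP k) (ηR i)) * ∫ w, f w ∂(νR i) := by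
  have hs := (h.summable_coef_prod_apply hf x).prod_symm.prod
  refine hs.congr fun i => ?_
  rw [← tsum_mul_right]
  refine tsum_congr fun k => ?_
  simp only [Prod.swap, mul_assoc]

/-- Exchange of the two sums in the limit of the expansion on `D₁`. -/
lemma limitFun_jump_topLimit [IsMarkovKernel K]
    (h : ReducibleSetting K hD₁ hD₂ WP WR νP νR ηP ηR αP αR l) {f : E → ℝ} {M : ℝ}
    (hf : ∀ x ∈ D₂, |f x| ≤ M * WR x) (x : E) :
    limitFun νP ηP (fun y => ∫ z, Hk f z ∂(K.restrict hD₂ y)) x =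
      ∑' i, (∑' k, ηP k x * entranceCoef K hD₂ l (νP k) (ηR i)) * ∫ w, f w ∂(νR i) := by
  have hs := h.summable_coef_prod_apply hf x
  unfold limitFun
  calc _ = ∑' k, ∑' i, ηP k x * (entranceCoef K hD₂ l (νP k) (ηR i) * ∫ w, f w ∂(νR i)) := by
        refine tsum_congr fun k => ?_
        rw [h.integral_jump_topLimit hf k, tsum_mul_left]
    _ = ∑' i, ∑' k, ηP k x * (entranceCoef K hD₂ l (νP k) (ηR i) * ∫ w, f w ∂(νR i)) :=
        (Summable.tsum_comm (f := fun k i => ηP k x * (entranceCoef K hD₂ l (νP k) (ηR i) * ∫ w, f w ∂(νR i)))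
          hs).symm
    _ = _ := by
        refine tsum_congr fun i => ?_
        rw [← tsum_mul_right]
        simp only [mul_assoc]

/-! ### Parameters of the semigroup on D₁ ∪ D₂ -/

/-- The expansion for f = 1: the rates are bounded, hence so is their Cesàro average, and the
normalized mass stays bounded. -/
lemma exists_left_mass_le [IsMarkovKernel K]
    (h : ReducibleSetting K hD₁ hD₂ WP WR νP νR ηP ηR αP αR l) {x : E} (hx : x ∈ D₁) :
    ∃ C : ℝ, ∀ n : ℕ, 1 ≤ n → killKernel K (hD₁.union hD₂) n x Set.univ ≤
      ENNReal.ofReal (C * (expParam₀ (fun n x => killKernel K hD₁ n x) D₁).toReal ^ n *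
        (n : ℝ) ^ (l + 1)) := by
  obtain ⟨C, hC0, hC⟩ := h.exists_left_expansion
  obtain ⟨aP, haP0, haP⟩ := h.left.exists_α_le
  obtain ⟨aR, haR0, haR⟩ := h.right.exists_α_le
  have hθ := h.left.theta_pos
  set θ := (expParam₀ (fun n x => killKernel K hD₁ n x) D₁).toReal with hθdef
  set L := θ⁻¹ / (1 + l) * limitFun νP ηP (fun y => ∫ z,
    topLimit (polyParam (fun n x => killKernel K hD₂ n x) D₂) l νR ηR (fun _ => 1) z
      ∂(K.restrict hD₂ y)) x with hL
  refine ⟨C * (2 * (aP + aR)) * WP x + |L|, fun n hn => ?_⟩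
  have hn0 : (0 : ℝ) < n := by exact_mod_cast hn
  have hn1 : (1 : ℝ) ≤ n := by exact_mod_cast hn
  have hW := h.left.W_nonneg x
  have hone : ∀ y ∈ D₁ ∪ D₂, |(1 : ℝ)| ≤ 1 * (WP + WR) y := fun y hy => by
    rw [abs_one, one_mul]; exact h.one_le_W y hy
  have hb := hC (fun _ => 1) measurable_const 1 hone n hn x hx
  have hsum : ∑ k ∈ Finset.range (n + 1), (αP k + αR k) ≤ n * (2 * (aP + aR)) := by
    calc _ ≤ ∑ _k ∈ Finset.range (n + 1), (aP + aR) :=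
          Finset.sum_le_sum fun k _ => add_le_add (haP k) (haR k)
      _ = (n + 1) * (aP + aR) := by
          rw [Finset.sum_const, Finset.card_range, nsmul_eq_mul]; push_cast; rfl
      _ ≤ (n + n) * (aP + aR) := by gcongr
      _ = _ := by ring
  have herr : C / n * (∑ k ∈ Finset.range (n + 1), (αP k + αR k)) * (WP x * 1) ≤
      C * (2 * (aP + aR)) * WP x := by
    calc _ ≤ C / n * (n * (2 * (aP + aR))) * (WP x * 1) := by gcongr
      _ = _ := by field_simp
  have hmass : (θ ^ n)⁻¹ * ((n : ℝ) ^ (l + 1))⁻¹ *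
      (killKernel K (hD₁.union hD₂) n x).real Set.univ ≤ C * (2 * (aP + aR)) * WP x + |L| := by
    rw [integral_const, smul_eq_mul, mul_one] at hb
    have h1 := (abs_le.1 (hb.trans herr)).2
    have h2 := le_abs_self L
    linarith
  rw [← ofReal_measureReal]
  refine ENNReal.ofReal_le_ofReal ?_
  have := mul_le_mul_of_nonneg_right hmass
    (show 0 ≤ θ ^ n * (n : ℝ) ^ (l + 1) by positivity)
  calc _ = _ := ?_
    _ ≤ _ := this
    _ = _ := by ring
  field_simp

/-- Points of D₂ have the same parameter for both semigroups and already give the supremum, as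
θ_{0,R} = θ_{0,P}; points of D₁ do not exceed it by the mass bound. -/
lemma expParam₀_union [IsMarkovKernel K]
    (h : ReducibleSetting K hD₁ hD₂ WP WR νP νR ηP ηR αP αR l) :
    expParam₀ (fun n x => killKernel K (hD₁.union hD₂) n x) (D₁ ∪ D₂) =
      expParam₀ (fun n x => killKernel K hD₁ n x) D₁ := by
  have hR : ∀ x ∈ D₂, expParam (fun n x => killKernel K (hD₁.union hD₂) n x) x =
      expParam (fun n x => killKernel K hD₂ n x) x := fun x hx => by
    simp only [expParam, killKernel_union_of_mem_right hD₁ hD₂ h.disjoint h.closed hx]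
  refine le_antisymm (iSup₂_le ?_) ?_
  · rintro x (hx | hx)
    · obtain ⟨C, hC⟩ := h.exists_left_mass_le hx
      exact expParam_le_of_le h.left.exp_pos h.left.exp_le_one hC
    · rw [hR x hx, ← h.expParam_eq]
      exact le_iSup₂ (f := fun x (_ : x ∈ D₂) => expParam (fun n x => killKernel K hD₂ n x) x) x hx
  · rw [← h.expParam_eq]
    refine iSup₂_le fun x hx => ?_
    rw [← hR x hx]
    exact le_iSup₂ (f := fun x (_ : x ∈ D₁ ∪ D₂) =>
      expParam (fun n x => killKernel K (hD₁.union hD₂) n x) x) x (Or.inr hx)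

lemma polyParam_union_of_mem_right [IsMarkovKernel K]
    (h : ReducibleSetting K hD₁ hD₂ WP WR νP νR ηP ηR αP αR l) {x : E} (hx : x ∈ D₂) :
    polyParam (fun n x => killKernel K (hD₁.union hD₂) n x) (D₁ ∪ D₂) x =
      polyParam (fun n x => killKernel K hD₂ n x) D₂ x := by
  simp only [polyParam, h.expParam₀_union, h.expParam_eq,
    killKernel_union_of_mem_right hD₁ hD₂ h.disjoint h.closed hx]

/-- The mass bound makes the lower limit vanish for every q > l + 1, and q then decreases to l + 1.
-/
lemma polyParam_union_le_of_mem_left [IsMarkovKernel K]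
    (h : ReducibleSetting K hD₁ hD₂ WP WR νP νR ηP ηR αP αR l) {x : E} (hx : x ∈ D₁) :
    polyParam (fun n x => killKernel K (hD₁.union hD₂) n x) (D₁ ∪ D₂) x ≤ 1 + l := by
  refine le_of_forall_gt_imp_ge_of_dense fun q hq => ?_
  have hq' : ((l + 1 : ℕ) : ℝ) < q := by push_cast; linarith
  obtain ⟨C, hC⟩ := h.exists_left_mass_le hx
  refine polyParam_le ((Nat.cast_nonneg _).trans hq'.le) ?_
  refine polyLiminf_eq_zero_of_le (p := l + 1) (C := C) ?_ ?_ ?_ hq'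
  · rw [h.expParam₀_union]; exact h.left.exp_pos
  · rw [h.expParam₀_union]; exact h.left.exp_le_one
  · rw [h.expParam₀_union]; exact hC

end ReducibleSetting

/-! ### From the Markov chain to the kernel setting -/

section Chain

variable {K : Kernel E E} {X : ℕ → Ω → E} {Pr : E → Measure Ω}

lemma killedLaw_eq_fun (hX : IsMarkovChain K X Pr) {A : Set E} (hA : MeasurableSet A) :
    killedLaw X Pr A = fun n x => killKernel K hA n x := by
  funext n x
  exact killedLaw_eq_killKernel hA hX n x

lemma setIntegral_lt_hitTime (hX : IsMarkovChain K X Pr) {A : Set E} (hA : MeasurableSet A)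
    {f : E → ℝ} (hf : Measurable f) (n : ℕ) (x : E) :
    ∫ ω in {ω | (n : ℕ∞) < hitTime X Aᶜ ω}, f (X n ω) ∂(Pr x) =
      ∫ y, f y ∂(killKernel K hA n x) := by
  rw [← killedLaw_eq_killKernel hA hX, killedLaw,
    integral_map (hX.meas n).aemeasurable hf.aestronglyMeasurable]

lemma setLIntegral_lt_hitTime (hX : IsMarkovChain K X Pr) {A : Set E} (hA : MeasurableSet A)
    {f : E → ℝ≥0∞} (hf : Measurable f) (n : ℕ) (x : E) :
    ∫⁻ ω in {ω | (n : ℕ∞) < hitTime X Aᶜ ω}, f (X n ω) ∂(Pr x) =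
      ∫⁻ y, f y ∂(killKernel K hA n x) := by
  rw [← killedLaw_eq_killKernel hA hX, killedLaw, lintegral_map hf (hX.meas n)]

lemma hitTime_eq_one {E Ω : Type*} {X : ℕ → Ω → E} {A : Set E} {ω : Ω} (h0 : X 0 ω ∉ A)
    (h1 : X 1 ω ∈ A) : hitTime X A ω = 1 := by
  refine le_antisymm (iInf₂_le_of_le 1 h1 le_rfl) ?_
  have : ((0 : ℕ) : ℕ∞) < hitTime X A ω := lt_hitTime_iff.2 fun i hi => by
    rwa [Nat.le_zero.1 hi]
  exact Order.one_le_iff_ne_zero.2 (by simpa using this.ne')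

lemma kernel_eq_zero_of_hitTime (hX : IsMarkovChain K X Pr) {A : Set E} (hA : MeasurableSet A)
    {x : E} (h : ∀ᵐ ω ∂(Pr x), hitTime X A ω = ⊤) : K x A = 0 := by
  rw [← map_one_eq hX x, Measure.map_apply (hX.meas 1) hA]
  refine measure_mono_null (fun ω hω => ?_) (ae_iff.1 h)
  exact fun htop => hitTime_eq_top_iff.1 htop 1 hω

lemma ae_start (hX : IsMarkovChain K X Pr) {A : Set E} (hA : MeasurableSet A) {x : E}
    (hx : x ∈ A) : ∀ᵐ ω ∂(Pr x), X 0 ω ∈ A := by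
  refine (ae_map_iff (hX.meas 0).aemeasurable hA).1 ?_
  rw [hX.start x]
  exact (ae_dirac_iff hA).2 hx

/-- A path from D₁ with X 1 in D₂ enters at time 1, so the bound at the entrance time restricts the
one-step kernel. As every starting point of D₁ is allowed, later crossings are covered too. -/
lemma EntranceBound.ae_jump_le (hX : IsMarkovChain K X Pr) {D₁ D₂ : Set E} {l : ℕ}
    (hl : EntranceBound X Pr D₁ D₂ l) (hD₁ : MeasurableSet D₁) (hD₂ : MeasurableSet D₂)
    (hdisj : Disjoint D₁ D₂) (hj : Measurable (jParam X Pr D₂)) {x : E} (hx : x ∈ D₁) :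
    ∀ᵐ z ∂(K.restrict hD₂ x), jParam X Pr D₂ z ≤ l := by
  rw [Kernel.restrict_apply, ae_restrict_iff' hD₂, ← map_one_eq hX x]
  have hms : MeasurableSet {z | z ∈ D₂ → jParam X Pr D₂ z ≤ l} := by
    have : {z | z ∈ D₂ → jParam X Pr D₂ z ≤ l} = D₂ᶜ ∪ {z | jParam X Pr D₂ z ≤ l} := by
      ext z
      simp only [Set.mem_ofPred_eq, Set.mem_union, Set.mem_compl_iff]
      tauto
    rw [this]
    exact hD₂.compl.union (measurableSet_le hj measurable_const)
  rw [ae_map_iff (hX.meas 1).aemeasurable hms]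
  filter_upwards [hl x hx, ae_start hX hD₁ hx] with ω hω h0 h1
  have ht := hitTime_eq_one (fun h2 => hdisj.le_bot ⟨h0, h2⟩) h1
  rw [ht] at hω
  simpa using hω (by simp)

/-- A Markov chain satisfying the hypotheses of the reducible case yields a `ReducibleSetting`. -/
lemma reducibleSetting {IP IR : Type*} {WP WR : E → ℝ} {νP : IP → Measure E}
    {νR : IR → Measure E} {ηP : IP → E → ℝ} {ηR : IR → E → ℝ} {αP αR : ℕ → ℝ} {l : ℕ}
    [IsMarkovKernel K] (hX : IsMarkovChain K X Pr) {D₁ D₂ : Set E} (hD₁ : MeasurableSet D₁)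
    (hD₂ : MeasurableSet D₂) (hdisj : Disjoint D₁ D₂)
    (hD₂D₁ : ∀ x ∈ D₂, ∀ᵐ ω ∂(Pr x), hitTime X D₁ ω = ⊤)
    (hAP : AssumptionA (killedLaw X Pr D₁) D₁ WP νP ηP αP)
    (hAR : AssumptionA (killedLaw X Pr D₂) D₂ WR νR ηR αR)
    (hαP : αP 0 = 1) (hαR : αR 0 = 1) (hjP : polyParam₀ (killedLaw X Pr D₁) D₁ = 0)
    (hθ : expParam₀ (killedLaw X Pr D₂) D₂ = expParam₀ (killedLaw X Pr D₁) D₁)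
    (hW : ∀ x ∈ D₁, ∫⁻ ω, ENNReal.ofReal (WR (X 1 ω)) ∂(Pr x) ≤ ENNReal.ofReal (WP x))
    (hl : EntranceBound X Pr D₁ D₂ l) :
    ReducibleSetting K hD₁ hD₂ WP WR νP νR ηP ηR αP αR l := by
  rw [killedLaw_eq_fun hX hD₁] at hAP hjP hθ
  rw [killedLaw_eq_fun hX hD₂] at hAR hθ
  have hjm : Measurable (jParam X Pr D₂) := by
    have := hAR.measurable_polyParam (fun _ => inferInstance)
      fun n _ hx => killKernel_apply_of_notMem hD₂ hx n
    unfold jParam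
    rw [killedLaw_eq_fun hX hD₂]
    exact this
  refine ⟨hdisj, fun y hy => kernel_eq_zero_of_hitTime hX hD₁ (hD₂D₁ y hy), hAP, hAR, hαP, hαR,
    fun x hx => ?_, hθ, fun y hy => ?_, fun y hy => ?_⟩
  · refine le_antisymm ?_ (polyParam_nonneg _ _ _)
    rw [← ENNReal.ofReal_eq_zero, ← nonpos_iff_eq_zero, ← hjP]
    exact le_iSup₂ (f := fun x (_ : x ∈ D₁) =>
      ENNReal.ofReal (polyParam (fun n x => killKernel K hD₁ n x) D₁ x)) x hx
  · rw [← map_one_eq hX y, lintegral_map hAR.W_meas.ennreal_ofReal (hX.meas 1)]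
    exact hW y hy
  · have := hl.ae_jump_le hX hD₁ hD₂ hdisj hjm hy
    unfold jParam at this
    rwa [killedLaw_eq_fun hX hD₂] at this

lemma entranceMean_eq {IP IR : Type*} {WP WR : E → ℝ} {νP : IP → Measure E}
    {νR : IR → Measure E} {ηP : IP → E → ℝ} {ηR : IR → E → ℝ} {αP αR : ℕ → ℝ} {l : ℕ}
    [IsMarkovKernel K] (hX : IsMarkovChain K X Pr) {D₁ D₂ : Set E} {hD₁ : MeasurableSet D₁}
    {hD₂ : MeasurableSet D₂} (h : ReducibleSetting K hD₁ hD₂ WP WR νP νR ηP ηR αP αR l)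
    (k : IP) (i : IR) :
    entranceMean X Pr D₂ l (νP k) (ηR i) = entranceCoef K hD₂ l (νP k) (ηR i) := by
  have := h.left.ν_prob k
  rw [entranceCoef, ReducibleSetting.integral_bind_jump
    (h.integrable_indicator_η i (h.integrable_bind_jump k)), entranceMean, stepMean]
  unfold jParam
  rw [killedLaw_eq_fun hX hD₂]
  refine integral_congr_ae (ae_of_all _ fun x => ?_)
  dsimp only
  have hm := h.measurable_indicator_η i
  have h1 := integral_map (hX.meas 1).aemeasurable (μ := Pr x) hm.aestronglyMeasurable
  rw [← h1, map_one_eq hX x, Kernel.restrict_apply]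
  -- Restricting the kernel to D₂ loses nothing, because η_{R,i} vanishes off D₂.
  refine (setIntegral_eq_integral_of_forall_compl_eq_zero fun z hz => ?_).symm
  exact Set.indicator_apply_eq_zero.2 fun _ => h.right.η_zero i z hz

end Chain

/-! ### Comparison of the rates -/

/-- The expansion is proved without the summand l in the rate; adding it only enlarges the bound. -/
lemma alphaWeak_ge {αP αR : ℕ → ℝ} {l n : ℕ} (hn : 1 ≤ n) (hP : ∀ k, 0 ≤ αP k)
    (hR : ∀ k, 0 ≤ αR k) {c C : ℝ} (hc : 0 ≤ c) (hcC : c ≤ C) :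
    c / n * (∑ k ∈ Finset.range (n + 1), (αP k + αR k)) ≤ alphaWeak C l αP αR n := by
  have hn0 : (0 : ℝ) < n := by exact_mod_cast hn
  have hS : 0 ≤ ∑ k ∈ Finset.range (n + 1), (αP k + αR k) :=
    Finset.sum_nonneg fun k _ => add_nonneg (hP k) (hR k)
  have hC := hc.trans hcC
  unfold alphaWeak
  have : (0 : ℝ) ≤ l := l.cast_nonneg
  gcongr
  linarith

/-- Monotonicity gives n αR n ≤ ∑_{k=1}^n αR k: the last term is at most the average. -/
lemma le_alphaWeak_of_antitone {αP αR : ℕ → ℝ} {l n : ℕ} (hn : 1 ≤ n) (hP : ∀ k, 0 ≤ αP k)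
    (hR : ∀ k, 0 ≤ αR k) {C : ℝ} (hC : 1 ≤ C) (hα : AntitoneOn αR (Set.Ici 1)) :
    αR n ≤ alphaWeak C l αP αR n := by
  have hn0 : (0 : ℝ) < n := by exact_mod_cast hn
  refine le_trans ?_ (alphaWeak_ge hn hP hR zero_le_one hC)
  have h1 : n * αR n ≤ ∑ k ∈ Finset.range (n + 1), αR k := by
    rw [Finset.sum_range_succ']
    have : ∑ _k ∈ Finset.range n, αR n ≤ ∑ k ∈ Finset.range n, αR (k + 1) :=
      Finset.sum_le_sum fun k hk => hα (Set.mem_Ici.2 (by omega)) (Set.mem_Ici.2 hn)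
        (by have := Finset.mem_range.1 hk; omega)
    rw [Finset.sum_const, Finset.card_range, nsmul_eq_mul] at this
    linarith [hR 0]
  have h2 : ∑ k ∈ Finset.range (n + 1), αR k ≤ ∑ k ∈ Finset.range (n + 1), (αP k + αR k) :=
    Finset.sum_le_sum fun k _ => by linarith [hP k]
  rw [div_mul_eq_mul_div, one_mul, le_div_iff₀ hn0]
  linarith

end ReducibleQSD

end

/-! ### The theorem on the chain -/

theorem corollary3p2 {E Ω IP IR : Type*} [MeasurableSpace E] [MeasurableSpace Ω]
    -- the state space `E = D ∪ {∂}`, with `D` partitioned into `D₁` and `D₂`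
    (cem : E) (hcem : MeasurableSet {cem})
    (D₁ D₂ : Set E) (hD₁ : MeasurableSet D₁) (hD₂ : MeasurableSet D₂)
    (hdisj : Disjoint D₁ D₂) (hunion : D₁ ∪ D₂ = {cem}ᶜ)
    -- the Markov process, absorbed at the cemetery point, which cannot go from `D₂` to `D₁`
    (K : Kernel E E) [IsMarkovKernel K] (X : ℕ → Ω → E) (Pr : E → Measure Ω)
    (hX : IsMarkovChain K X Pr)
    (habs : K cem {cem} = 1)
    (hD₂D₁ : ∀ x ∈ D₂, ∀ᵐ ω ∂(Pr x), hitTime X D₁ ω = ⊤)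
    -- Assumption (A) for the process restricted to `D₁` and for the process restricted to `D₂`
    (WP WR : E → ℝ) (νP : IP → Measure E) (νR : IR → Measure E)
    (ηP : IP → E → ℝ) (ηR : IR → E → ℝ) (αP αR : ℕ → ℝ)
    (hAP : AssumptionA (killedLaw X Pr D₁) D₁ WP νP ηP αP)
    (hAR : AssumptionA (killedLaw X Pr D₂) D₂ WR νR ηR αR)
    -- the convention `α_{P,0} = α_{R,0} = 1`
    (hαP : αP 0 = 1) (hαR : αR 0 = 1)
    (hjP : polyParam₀ (killedLaw X Pr D₁) D₁ = 0)
    (hjR : polyParam₀ (killedLaw X Pr D₂) D₂ < ∞)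
    (hθ : expParam₀ (killedLaw X Pr D₂) D₂ = expParam₀ (killedLaw X Pr D₁) D₁)
    (hW : ∀ x ∈ D₁, ∫⁻ ω, ENNReal.ofReal (WR (X 1 ω)) ∂(Pr x) ≤ ENNReal.ofReal (WP x))
    -- `l` is the smallest `ℓ` such that `j_R (X_{T_{D₂}}) ≤ ℓ` almost surely from all of `D₁`
    (l : ℕ) (hl : IsLeast {m : ℕ | EntranceBound X Pr D₁ D₂ m} l) :
    -- the expectations are finite and the series converge
    (∀ n : ℕ, ∀ x ∈ D₁ ∪ D₂,
      ∫⁻ ω in {ω | (n : ℕ∞) < hitTime X {cem} ω},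
        ENNReal.ofReal ((WP + WR) (X n ω)) ∂(Pr x) < ∞) ∧
    (∀ i, ∀ x ∈ D₁ ∪ D₂,
      Summable fun k => ηP k x * entranceMean X Pr D₂ l (νP k) (ηR i)) ∧
    (∀ f, MemLW (D₁ ∪ D₂) (WP + WR) f → ∀ x ∈ D₁ ∪ D₂,
      Summable fun i => etaWeak X Pr D₁ D₂ l νP ηP (ηR i) x * ∫ y, f y ∂(νR i)) ∧
    -- the estimate, with a constant that depends neither on `x`, nor on `n`, nor on `f`
    (∃ C : ℝ, 0 < C ∧
      (∀ f, MemLW (D₁ ∪ D₂) (WP + WR) f → ∀ n : ℕ, 1 ≤ n → ∀ x ∈ D₁,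
        expansionError X Pr cem (theta X Pr D₁) (jWeak X Pr D₁ D₂ l) νR
            (fun i => etaWeak X Pr D₁ D₂ l νP ηP (ηR i)) n x f
          ≤ alphaWeak C l αP αR n * (WP + WR) x * normLW (D₁ ∪ D₂) (WP + WR) f) ∧
      (∀ f, MemLW (D₁ ∪ D₂) (WP + WR) f → ∀ n : ℕ, 1 ≤ n → ∀ x ∈ D₂,
        expansionError X Pr cem (theta X Pr D₁) (jWeak X Pr D₁ D₂ l) νR
            (fun i => etaWeak X Pr D₁ D₂ l νP ηP (ηR i)) n x f
          ≤ αR n * (WP + WR) x * normLW (D₁ ∪ D₂) (WP + WR) f) ∧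
      (AntitoneOn αR (Set.Ici 1) →
        ∀ f, MemLW (D₁ ∪ D₂) (WP + WR) f → ∀ n : ℕ, 1 ≤ n → ∀ x ∈ D₁ ∪ D₂,
        expansionError X Pr cem (theta X Pr D₁) (jWeak X Pr D₁ D₂ l) νR
            (fun i => etaWeak X Pr D₁ D₂ l νP ηP (ηR i)) n x f
          ≤ alphaWeak C l αP αR n * (WP + WR) x * normLW (D₁ ∪ D₂) (WP + WR) f)) ∧
    -- comparison of the exponent `j` with the parameters `j_R` and `j_S`
    (∀ x ∈ D₂, jParam X Pr D₂ x = jWeak X Pr D₁ D₂ l x ∧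
      jParam X Pr (D₁ ∪ D₂) x = jWeak X Pr D₁ D₂ l x) ∧
    (∀ x ∈ D₁, jParam X Pr D₂ x ≤ jWeak X Pr D₁ D₂ l x ∧
      jParam X Pr (D₁ ∪ D₂) x ≤ jWeak X Pr D₁ D₂ l x) := by
  have hc : {cem} = (D₁ ∪ D₂)ᶜ := by rw [hunion, compl_compl]
  have h := reducibleSetting hX hD₁ hD₂ hdisj hD₂D₁ hAP hAR hαP hαR hjP hθ hW hl.1
  have hκP := killedLaw_eq_fun hX hD₁
  have hκR := killedLaw_eq_fun hX hD₂
  have hcoef : ∀ k i, entranceMean X Pr D₂ l (νP k) (ηR i) =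
      entranceCoef K hD₂ l (νP k) (ηR i) := entranceMean_eq hX h
  have hbound : ∀ f, MemLW (D₁ ∪ D₂) (WP + WR) f → ∀ x ∈ D₁ ∪ D₂,
      |f x| ≤ normLW (D₁ ∪ D₂) (WP + WR) f * (WP + WR) x :=
    fun f hf x hx => hf.abs_le h.one_le_W hx
  have heta₂ : ∀ i, ∀ x ∈ D₂, etaWeak X Pr D₁ D₂ l νP ηP (ηR i) x = ηR i x := by
    intro i x hx
    have : ∀ k, ηP k x = 0 := fun k => h.left.η_zero k x fun hx' => hdisj.le_bot ⟨hx', hx⟩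
    simp [etaWeak, this]
  have heta : ∀ i x, etaWeak X Pr D₁ D₂ l νP ηP (ηR i) x = ηR i x +
      (theta X Pr D₁)⁻¹ / (1 + l) * ∑' k, ηP k x * entranceCoef K hD₂ l (νP k) (ηR i) := by
    intro i x
    simp only [etaWeak, hcoef]
  have hright : ∀ f, MemLW (D₁ ∪ D₂) (WP + WR) f → ∀ n : ℕ, 1 ≤ n → ∀ x ∈ D₂,
      expansionError X Pr cem (theta X Pr D₁) (jWeak X Pr D₁ D₂ l) νR
          (fun i => etaWeak X Pr D₁ D₂ l νP ηP (ηR i)) n x f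
        ≤ αR n * (WP + WR) x * normLW (D₁ ∪ D₂) (WP + WR) f := by
    intro f hf n hn x hx
    have hx₁ : x ∉ D₁ := fun hx' => hdisj.le_bot ⟨hx', hx⟩
    have hb := h.right.estimate_of_le hf.1 (h.abs_le_right (hbound f hf)) hn hx
    have hW' : (WP + WR) x = WR x := by simp [h.WP_eq_zero hx]
    rw [hW']
    rw [h.expParam_eq] at hb
    unfold expansionError
    rw [hc, setIntegral_lt_hitTime hX (hD₁.union hD₂) hf.1,
      killKernel_union_of_mem_right hD₁ hD₂ hdisj h.closed hx]
    simp only [heta₂ _ x hx, jWeak, if_neg hx₁, jParam, theta, hκP, hκR]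
    exact hb
  refine ⟨fun n x hx => ?_, fun i x _ => ?_, fun f hf x _ => ?_, ?_, fun x hx => ?_,
    fun x hx => ?_⟩
  · rw [hc, setLIntegral_lt_hitTime hX (hD₁.union hD₂) h.measurable_W.ennreal_ofReal]
    exact h.lintegral_union_lt_top n hx
  · simp only [hcoef]
    exact h.summable_coef i x
  · have hfR := h.abs_le_right (hbound f hf)
    simp only [heta, add_mul, mul_assoc]
    exact (h.right.summable_abs_limitFun hfR x).of_abs.add
      ((h.summable_coef_apply hfR x).mul_left _)
  · obtain ⟨C, hC0, hC⟩ := h.exists_left_expansion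
    have hleft : ∀ f, MemLW (D₁ ∪ D₂) (WP + WR) f → ∀ n : ℕ, 1 ≤ n → ∀ x ∈ D₁,
        expansionError X Pr cem (theta X Pr D₁) (jWeak X Pr D₁ D₂ l) νR
            (fun i => etaWeak X Pr D₁ D₂ l νP ηP (ηR i)) n x f
          ≤ alphaWeak (max C 1) l αP αR n * (WP + WR) x * normLW (D₁ ∪ D₂) (WP + WR) f := by
      intro f hf n hn x hx
      have hfb := hbound f hf
      have hfR := h.abs_le_right hfb
      have hM := h.right.bound_nonneg hfR
      have hn0 : (0 : ℝ) < n := by exact_mod_cast hn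
      have hx₂ : x ∉ D₂ := fun hx' => hdisj.le_bot ⟨hx, hx'⟩
      have hW' : (WP + WR) x = WP x := by simp [h.WR_eq_zero hx]
      -- On D₁ the functions η_{R,i} vanish, so only the crossing part of the coefficient remains;
      -- the two sums can then be exchanged.
      have hlim : ∑' i, etaWeak X Pr D₁ D₂ l νP ηP (ηR i) x * ∫ y, f y ∂(νR i) =
          (theta X Pr D₁)⁻¹ / (1 + l) * limitFun νP ηP (fun y => ∫ z,
            topLimit (polyParam (fun n x => killKernel K hD₂ n x) D₂) l νR ηR f z
              ∂(K.restrict hD₂ y)) x := by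
        rw [h.limitFun_jump_topLimit hfR x, ← tsum_mul_left]
        refine tsum_congr fun i => ?_
        rw [heta, h.right.η_zero i x hx₂, zero_add, mul_assoc]
      have hpow : (n : ℝ) ^ (-jWeak X Pr D₁ D₂ l x) = ((n : ℝ) ^ (l + 1))⁻¹ := by
        rw [jWeak, if_pos hx, Real.rpow_neg hn0.le, add_comm, ← Nat.cast_add_one,
          Real.rpow_natCast]
      have hb := hC f hf.1 _ hfb n hn x hx
      unfold expansionError
      rw [hlim, hpow, hc, setIntegral_lt_hitTime hX (hD₁.union hD₂) hf.1, hW', mul_assoc _ (WP x)]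
      simp only [theta, hκP]
      refine hb.trans (mul_le_mul_of_nonneg_right ?_ (mul_nonneg (h.left.W_nonneg x) hM))
      exact alphaWeak_ge hn h.αP_nonneg h.αR_nonneg hC0 (le_max_left _ _)
    -- The expansion on D₁ requires C; the value 1 ensures positivity and lets the rate dominate αR
    -- on D₂ in the monotone case.
    refine ⟨max C 1, lt_max_of_lt_right one_pos, hleft, hright, fun hα f hf n hn x hx => ?_⟩
    rcases hx with hx | hx
    · exact hleft f hf n hn x hx
    · have hM := h.right.bound_nonneg (h.abs_le_right (hbound f hf))
      refine (hright f hf n hn x hx).trans (mul_le_mul_of_nonneg_right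
        (mul_le_mul_of_nonneg_right ?_ (h.W_nonneg x)) hM)
      exact le_alphaWeak_of_antitone hn h.αP_nonneg h.αR_nonneg (le_max_right _ _) hα
  · have hx₁ : x ∉ D₁ := fun hx' => hdisj.le_bot ⟨hx', hx⟩
    simp only [jWeak, if_neg hx₁, jParam, true_and]
    rw [killedLaw_eq_fun hX (hD₁.union hD₂), hκR]
    exact h.polyParam_union_of_mem_right hx
  · have hx₂ : x ∉ D₂ := fun hx' => hdisj.le_bot ⟨hx, hx'⟩
    simp only [jWeak, if_pos hx, jParam]
    rw [killedLaw_eq_fun hX (hD₁.union hD₂), hκR]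
    refine ⟨?_, h.polyParam_union_le_of_mem_left hx⟩
    rw [polyParam_of_zero fun n => killKernel_apply_of_notMem hD₂ hx₂ n]
    positivity
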